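/- **Setting.** Let $(Z,d)$ be a metric space of objects and $\mathcal X\subseteq Z$ an input domain. For $\delta>0$ let $N(\delta;\mathcal X,d)$ be the smallest number of points of $\mathcal X$ such that every $x\in\mathcal X$ is within distance $\delta$ of one of them. Assume there are $p\ge 0$ and $c>0$ with $N(\delta;\mathcal X,d)\le c\,\delta^{-p}$ for all $0<\delta<1$; the effective dimension $p_{\mathcal X,d}$ is the smallest (infimal) such exponent $p$. Let $\gamma>0$, let $P$ be a Borel probability measure on $Z$ (the law of the random objects $\omega$), and put $\phi_\omega(x)=\exp(-\gamma d(x,\omega))$ and $k(x,x')=\int \phi_\omega(x)\phi_\omega(x')\,dP(\omega)$. Let $\mathcal H$ be the reproducing kernel Hilbert space of functions on $\mathcal X$ with kernel $k$. Let $\rho$ be a probability distribution of pairs $(x,y)\in\mathcal X\times\mathcal Y$ and $\ell:\mathbb R\times\mathcal Y\to\mathbb R$ a measurable loss with $|\ell(a,y)-\ell(b,y)|\le M|a-b|$ for all $a,b,y$, where $M>0$, and with $\mathbb E|\ell(0,y)|<\infty$. Write $L(f)=\mathbb E\,\ell(f(x),y)$, and $\hat L(f)=\frac1n\sum_{i=1}^n\ell(f(x_i),y_i)$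 for an i.i.d. sample $(x_i,y_i)_{i\le n}$ from $\rho$. For $C>0$ let $f_C$ be a minimizer of $L$, and $\hat f_n$ a minimizer of $\hat L$, over $\{f\in\mathcal H:\|f\|_{\mathcal H}\le C\}$. Let $f^*:\mathcal X\to\mathbb R$ be a target function whose loss $\ell(f^*(x),y)$ is integrable. **Algorithm 1** with regularization $\mu>0$: draw $\omega_1,\dots,\omega_R$ i.i.d. from $P$, independently of the sample; put $\hat\phi_j(x)=R^{-1/2}\exp(-\gamma d(x,\omega_j))$ for $j\le R$; let $\hat w$ minimize $\frac1n\sum_{i=1}^n\ell(w^T\hat\phi(x_i),y_i)+\frac\mu2\|w\|_2^2$ over $w\in\mathbb R^R$; output $\tilde f_R(x)=\hat w^T\hat\phi(x)$. **Claim.** There are absolute constants $c_1,c_2>0$ such that for all $C,\varepsilon>0$ there is a $\mu>0$, depending only on $C$ and $\varepsilon$, for which the following holds in every setting as above and for all $0<\delta<1$. Let $A>0$ be a number such that either $A\ge C$, or for almost every sample some empirical risk minimizer has the form $\hat f_n=\frac1n\sum_{i=1}^n\alpha_i k(x_i,\cdot)$ with $\frac1n\|\alpha\|_1\le A$. Suppose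 that 1. $L(f_C)-L(f^*)\le\varepsilon/2$; 2. $n\ \ge\ c_1M^2\max\{C^2,C^4\}\,\dfrac{\log(2/\delta)}{\varepsilon^2}$; 3. $R\ \ge\ c_2M^2A^2\,\dfrac{p_{\mathcal X,d}\log(2+1/\varepsilon)+\log(2/\delta)}{\varepsilon^2}$. Then, with probability at least $1-\delta$ over the sample and $\omega_1,\dots,\omega_R$, Algorithm 1 with this $\mu$ has an output, and every output $\tilde f_R$ satisfies $L(\tilde f_R)-L(f^*)\le\varepsilon$. -/

import Mathlib

open MeasureTheory
open scoped NNReal ENNReal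

namespace D2KE

noncomputable section

/-! ### Covering exponents and the effective dimension -/

/-- The exponents `p ≥ 0` for which there is `c > 0` with `N(δ; X, d) ≤ c (1/δ)^p` for all
`0 < δ < 1`, where `N(δ; X, d)` is the size of the smallest `δ`-cover of `X` by points of `X`. -/
def coverExponents {Z : Type*} [MetricSpace Z] (X : Set Z) : Set ℝ :=
  {p : ℝ | 0 ≤ p ∧ ∃ c : ℝ, 0 < c ∧ ∀ δ : ℝ, 0 < δ → δ < 1 →
    ((Metric.coveringNumber δ.toNNReal X : ℕ∞) : ℝ≥0∞) ≤ ENNReal.ofReal (c * (1 / δ) ^ p)}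

/-- The effective dimension: the smallest covering exponent (the infimum, so that it makes sense
also where the minimum is not attained). -/
def effectiveDimension {Z : Type*} [MetricSpace Z] (X : Set Z) : ℝ :=
  sInf (coverExponents X)

/-! ### The kernel and its reproducing kernel Hilbert space

The random objects `ω` and the inputs `x ∈ X` are points of one metric space `Z`; the
distribution of `ω` is a probability measure `P` on `Z`. -/

/-- The feature `φ_ω(x) = exp (-γ d(x, ω))`. -/
def phi {Z : Type*} [MetricSpace Z] (γ : ℝ≥0) (ω x : Z) : ℝ :=
  Real.exp (-(γ : ℝ) * dist x ω)

/-- The kernel `k(x, y) = ∫ φ_ω(x) φ_ω(y) dP(ω)`. -/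
def kernel {Z : Type*} [MetricSpace Z] [MeasurableSpace Z] (γ : ℝ≥0) (P : Measure Z)
    (x y : Z) : ℝ :=
  ∫ ω, phi γ ω x * phi γ ω y ∂P

/-- The kernel on `X`, as the operator-valued matrix of Mathlib's theory of reproducing kernel
Hilbert spaces (the entry at `(x, y)` is multiplication by `k(x, y)`). -/
def kernelMatrix {Z : Type*} [MetricSpace Z] [MeasurableSpace Z] (γ : ℝ≥0) (P : Measure Z)
    (X : Set Z) : Matrix X X (ℝ →L[ℝ] ℝ) :=
  Matrix.of fun x y => kernel γ P (x : Z) (y : Z) • ContinuousLinearMap.id ℝ ℝ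

lemma phi_nonneg {Z : Type*} [MetricSpace Z] (γ : ℝ≥0) (ω x : Z) : 0 ≤ phi γ ω x :=
  (Real.exp_pos _).le

lemma phi_le_one {Z : Type*} [MetricSpace Z] (γ : ℝ≥0) (ω x : Z) : phi γ ω x ≤ 1 := by
  unfold phi
  rw [Real.exp_le_one_iff]
  have h1 : 0 ≤ (γ : ℝ) * dist x ω := mul_nonneg γ.2 dist_nonneg
  linarith

lemma integrable_phi_mul_phi {Z : Type*} [MetricSpace Z] [MeasurableSpace Z] [BorelSpace Z]
    (γ : ℝ≥0) (P : Measure Z) [IsProbabilityMeasure P] (x y : Z) :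
    Integrable (fun ω => phi γ ω x * phi γ ω y) P := by
  have hc : Continuous fun ω => phi γ ω x * phi γ ω y := by
    unfold phi
    fun_prop
  refine Integrable.of_bound hc.measurable.aestronglyMeasurable 1 (Filter.Eventually.of_forall ?_)
  intro ω
  rw [Real.norm_of_nonneg (mul_nonneg (phi_nonneg γ ω x) (phi_nonneg γ ω y))]
  exact mul_le_one₀ (phi_le_one γ ω x) (phi_nonneg γ ω y) (phi_le_one γ ω y)

theorem posSemidef_kernelMatrix {Z : Type*} [MetricSpace Z] [MeasurableSpace Z] [BorelSpace Z]
    (γ : ℝ≥0) (P : Measure Z) [IsProbabilityMeasure P] (X : Set Z) :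
    (kernelMatrix γ P X).PosSemidef := by
  have tf := (RKHS.posSemidef_tfae (K := kernelMatrix γ P X)).out 0 2
  refine tf.mpr (And.intro ?_ ?_)
  · ext x y
    have hs : star (ContinuousLinearMap.id ℝ ℝ) = ContinuousLinearMap.id ℝ ℝ :=
      star_one (ℝ →L[ℝ] ℝ)
    simp [kernelMatrix, kernel, mul_comm, hs]
  · intro v
    have hint : ∀ x y : X, Integrable
        (fun ω : Z => v x * phi γ ω x * (v y * phi γ ω y)) P := by
      intro x y
      refine ((integrable_phi_mul_phi γ P (x : Z) (y : Z)).const_mul (v x * v y)).congr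
        (Filter.Eventually.of_forall fun ω => ?_)
      simp only
      ring
    have h : (v.sum fun x w => v.sum fun x' w' => inner ℝ (kernelMatrix γ P X x' x w) w')
        = ∫ ω : Z, (v.sum fun x w => w * phi γ ω x) ^ 2 ∂P := by
      simp only [Finsupp.sum, sq, Finset.sum_mul_sum]
      rw [integral_finsetSum _ fun x _ => integrable_finsetSum _ fun y _ => hint x y]
      refine Finset.sum_congr rfl fun x _ => ?_
      rw [integral_finsetSum _ fun y _ => hint x y]
      refine Finset.sum_congr rfl fun y _ => ?_
      have this : (fun ω : Z => v x * phi γ ω x * (v y * phi γ ω y))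
          = fun ω : Z => (v x * v y) * (phi γ ω y * phi γ ω x) := by
        funext ω; ring
      have h2 : ∫ ω : Z, v x * phi γ ω x * (v y * phi γ ω y) ∂P
          = (v x * v y) * ∫ ω : Z, phi γ ω y * phi γ ω x ∂P := by
        rw [this, integral_const_mul]
      refine Eq.trans ?_ h2.symm
      simp [kernelMatrix, kernel]
      ring
    rw [h]
    exact integral_nonneg fun ω => sq_nonneg _

instance fact_posSemidef_kernelMatrix {Z : Type*} [MetricSpace Z] [MeasurableSpace Z]
    [BorelSpace Z] (γ : ℝ≥0) (P : Measure Z) [IsProbabilityMeasure P] (X : Set Z) :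
    Fact (kernelMatrix γ P X).PosSemidef :=
  ⟨posSemidef_kernelMatrix γ P X⟩

/-- The reproducing kernel Hilbert space `ℋ` of functions on `X` with kernel `k`. -/
abbrev KernelSpace {Z : Type*} [MetricSpace Z] [MeasurableSpace Z] [BorelSpace Z] (γ : ℝ≥0)
    (P : Measure Z) [IsProbabilityMeasure P] (X : Set Z) :=
  RKHS.OfKernel (kernelMatrix γ P X)

/-! ### Risks and their minimizers -/

/-- Population risk `L(f) = E ℓ(f(x), y)` for `(x, y)` distributed as `ρ`. -/
def risk {I Y : Type*} [MeasurableSpace I] [MeasurableSpace Y] (loss : ℝ → Y → ℝ)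
    (ρ : Measure (I × Y)) (f : I → ℝ) : ℝ :=
  ∫ z, loss (f z.1) z.2 ∂ρ

/-- Empirical risk of `f` on the sample `S`. -/
def empiricalRisk {I Y : Type*} {n : ℕ} (loss : ℝ → Y → ℝ) (S : Fin n → I × Y) (f : I → ℝ) : ℝ :=
  (1 / (n : ℝ)) * ∑ i, loss (f (S i).1) (S i).2

/-- `f` minimizes the functional `J` over the ball `‖f‖_ℋ ≤ C`. -/
def IsBallMinimizer {Z : Type*} [MetricSpace Z] [MeasurableSpace Z] [BorelSpace Z] {γ : ℝ≥0}
    {P : Measure Z} [IsProbabilityMeasure P] {X : Set Z} (J : (X → ℝ) → ℝ) (C : ℝ)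
    (f : KernelSpace γ P X) : Prop :=
  ‖f‖ ≤ C ∧ ∀ g : KernelSpace γ P X, ‖g‖ ≤ C → J f ≤ J g

/-- On the sample `S`, some empirical risk minimizer over the ball of radius `C` has the form
`f̂_n = (1/n) ∑ αᵢ k(xᵢ, ·)` with `‖α‖₁ / n ≤ A`. -/
def HasERMCoefficientBound {Z Y : Type*} [MetricSpace Z] [MeasurableSpace Z] [BorelSpace Z]
    (γ : ℝ≥0) (P : Measure Z) [IsProbabilityMeasure P] (X : Set Z) {n : ℕ} (loss : ℝ → Y → ℝ)
    (C A : ℝ) (S : Fin n → X × Y) : Prop :=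
  ∃ (f : KernelSpace γ P X) (α : Fin n → ℝ),
    IsBallMinimizer (empiricalRisk loss S) C f ∧
    (∀ x : X, f x = (1 / (n : ℝ)) * ∑ i, α i * kernel γ P ((S i).1 : Z) (x : Z)) ∧
    (1 / (n : ℝ)) * ∑ i, |α i| ≤ A

/-! ### The random feature algorithm -/

/-- The random feature embedding `φ̂_j(x) = exp (-γ d(x, ω_j)) / √R`, `j = 1, …, R`. -/
def features {Z : Type*} [MetricSpace Z] {R : ℕ} (γ : ℝ≥0) (ω : Fin R → Z) (x : Z) :
    EuclideanSpace ℝ (Fin R) :=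
  WithLp.toLp 2 fun j => 1 / √(R : ℝ) * phi γ (ω j) x

/-- The linear function `x ↦ wᵀ φ̂(x)` on `X`. -/
def linearFunction {Z : Type*} [MetricSpace Z] {X : Set Z} {R : ℕ} (γ : ℝ≥0) (ω : Fin R → Z)
    (w : EuclideanSpace ℝ (Fin R)) : X → ℝ :=
  fun x => ∑ j, w j * features γ ω (x : Z) j

/-- The objective `(1/n) ∑ ℓ(wᵀ φ̂(xᵢ), yᵢ) + (μ/2) ‖w‖²`. -/
def objective {Z Y : Type*} [MetricSpace Z] {X : Set Z} {n R : ℕ} (γ : ℝ≥0) (loss : ℝ → Y → ℝ)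
    (μ : ℝ) (S : Fin n → X × Y) (ω : Fin R → Z) (w : EuclideanSpace ℝ (Fin R)) : ℝ :=
  empiricalRisk loss S (linearFunction γ ω w) + μ / 2 * ‖w‖ ^ 2

/-- `f` is an output of the random feature algorithm on the sample `S`, with the drawn random
objects `ω` and regularization `μ`: `f = ŵᵀ φ̂` for a minimizer `ŵ` of the objective. -/
def IsRandomFeatureEstimator {Z Y : Type*} [MetricSpace Z] {X : Set Z} {n R : ℕ} (γ : ℝ≥0)
    (loss : ℝ → Y → ℝ) (μ : ℝ) (S : Fin n → X × Y) (ω : Fin R → Z) (f : X → ℝ) : Prop :=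
  ∃ w : EuclideanSpace ℝ (Fin R),
    (∀ v, objective γ loss μ S ω w ≤ objective γ loss μ S ω v) ∧ f = linearFunction γ ω w

end

end D2KE

/-! Functions are never compared uniformly over `X`. Three events, each of probability at most
`δ/3`, are excluded, and the bounds for them are free of dimension. Covering numbers enter only
through separability of `X` and the nonnegativity of the effective dimension.

(1) For fixed random objects, the risk minus the empirical risk, both centered at the zero function,
is at most `(μ/2)‖w‖² + t` for all weights `w` at once: the regularizer itself pays for the supremum
(`measure_exists_deviation_le`). The exponential moment of the penalized supremum is bounded by
induction on the sample size. Symmetrization and contraction turn the contribution of one sample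
point into `±2m⟨w, φ⟩`, which is absorbed into a vector `u` carried through the induction; at the
end `⟨w, u⟩ - b‖w‖² ≤ ‖u‖²/(4b)`.

(2) The empirical risk of the single function `f_C` does not exceed its risk by much; this is the
same theorem with one index.

(3) For a fixed sample, some `h` with `‖h‖ ≤ B = min(A, C)` has empirical risk at most that of
`f_C`: either `f_C` itself, or the given empirical minimizer, whose coefficients bound its norm by
`A`. On the sample points, `h = E[G(ω) φ_ω]` with `E G² ≤ ‖h‖²` (`exists_weights_eq_on_points`).
Random features weighted by `G(ω_j)`, truncated at a level of order `MB²/ε`, reproduce `h` in the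
empirical `L¹` norm, which is all a Lipschitz loss sees, with `‖w‖² ≤ 4B²`. A Bernstein inequality
in Hilbert space (`measure_bernstein_le`) controls error and norm together.

Outside these events (`risk_estimator_sub_le`), up to centering, `L(ŵ) ≤ objective(ŵ) + t ≤
objective(w) + t ≤ L̂(f_C) + s + t ≤ L(f_C) + r + s + t`. -/

namespace D2KE

section Concentration

/-! ### Contraction and symmetrization for exponentials of finite maxima -/

/-- Convexity and monotonicity: an increment of `exp` grows with its base point and its length. -/
lemma exp_sub_exp_le_exp_sub_exp {x y x' y' : ℝ} (h : y - x ≤ y' - x') (hx : x ≤ x')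
    (hxy : x ≤ y) : Real.exp y - Real.exp x ≤ Real.exp y' - Real.exp x' := by
  have e1 : Real.exp y = Real.exp x * Real.exp (y - x) := by rw [← Real.exp_add]; ring_nf
  have e2 : Real.exp y' = Real.exp x' * Real.exp (y' - x') := by rw [← Real.exp_add]; ring_nf
  have h1 : Real.exp x ≤ Real.exp x' := Real.exp_le_exp.mpr hx
  have h2 : Real.exp (y - x) ≤ Real.exp (y' - x') := Real.exp_le_exp.mpr h
  have h3 : 1 ≤ Real.exp (y - x) := Real.one_le_exp (by linarith)
  have h4 := mul_le_mul h1 (sub_le_sub_right h2 1) (by linarith) (Real.exp_pos _).le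
  rw [e1, e2]
  linarith

/-- The two-point contraction inequality for the exponential function. -/
lemma exp_add_exp_le_max {a b g g' l l' : ℝ} (hg : |g| ≤ |l|) (hg' : |g'| ≤ |l'|)
    (hgg : |g - g'| ≤ |l - l'|) (h1 : b + g' ≤ a + g) (h2 : a - g ≤ b - g') :
    Real.exp (a + g) + Real.exp (b - g') ≤
      max (Real.exp (a + l) + Real.exp (b - l')) (Real.exp (a - l) + Real.exp (b + l')) := by
  have key : ∀ l l' : ℝ, 0 ≤ l → |g| ≤ |l| → |g'| ≤ |l'| → |g - g'| ≤ |l - l'| →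
      Real.exp (a + g) + Real.exp (b - g') ≤
      max (Real.exp (a + l) + Real.exp (b - l')) (Real.exp (a - l) + Real.exp (b + l')) := by
    intro l l' hl hg hg' hgg
    rw [abs_of_nonneg hl, abs_le] at hg
    rcases le_total l' 0 with hl' | hl'
    · rw [abs_of_nonpos hl', abs_le] at hg'
      exact le_max_of_le_left (add_le_add (Real.exp_le_exp.mpr (by linarith))
        (Real.exp_le_exp.mpr (by linarith)))
    · rw [abs_of_nonneg hl', abs_le] at hg'
      -- When `l` and `l'` have the same sign, one term falls short of its target and the other may
      -- exceed its own. The orderings `h1`, `h2` place the loss at the lower base point, so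
      -- convexity compensates it.
      rcases le_total l' l with hll | hll
      · rw [abs_of_nonneg (sub_nonneg.mpr hll), abs_le] at hgg
        refine le_max_of_le_left ?_
        have := exp_sub_exp_le_exp_sub_exp (x := b - l') (y := b - g') (x' := a + g)
          (y' := a + l) (by linarith) (by linarith) (by linarith)
        linarith
      · rw [abs_of_nonpos (sub_nonpos.mpr hll), abs_le] at hgg
        refine le_max_of_le_right ?_
        have := exp_sub_exp_le_exp_sub_exp (x := a - l) (y := a + g) (x' := b - g')
          (y' := b + l') (by linarith) (by linarith) (by linarith)
        linarith
  -- Negating `l` and `l'` together exchanges the two entries of the maximum.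
  rcases le_total 0 l with hl | hl
  · exact key l l' hl hg hg' hgg
  · have := key (-l) (-l') (by linarith) (by rwa [abs_neg]) (by rwa [abs_neg])
      (by rwa [show -l - -l' = -(l - l') by ring, abs_neg])
    rw [max_comm]
    simpa [sub_neg_eq_add, ← sub_eq_add_neg] using this

variable {ι : Type*}

/-- Ledoux–Talagrand contraction for one random sign and the exponential function. -/
lemma exp_sup'_contraction (T : Finset ι) (hT : T.Nonempty) (A g l : ι → ℝ)
    (h1 : ∀ i, |g i| ≤ |l i|) (h2 : ∀ i j, |g i - g j| ≤ |l i - l j|) :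
    Real.exp (T.sup' hT fun i => A i + g i) + Real.exp (T.sup' hT fun i => A i - g i) ≤
      Real.exp (T.sup' hT fun i => A i + l i) + Real.exp (T.sup' hT fun i => A i - l i) := by
  -- Optimality of the two maximizers supplies the ordering hypotheses of the two-point inequality.
  obtain ⟨i, hi, hi'⟩ := T.exists_mem_eq_sup' hT fun i => A i + g i
  obtain ⟨j, hj, hj'⟩ := T.exists_mem_eq_sup' hT fun i => A i - g i
  have k1 : A j + g j ≤ A i + g i := hi' ▸ T.le_sup' (fun i => A i + g i) hj
  have k2 : A i - g i ≤ A j - g j := hj' ▸ T.le_sup' (fun i => A i - g i) hi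
  rw [hi', hj']
  refine (exp_add_exp_le_max (h1 i) (h1 j) (h2 i j) k1 k2).trans (max_le ?_ ?_)
  · exact add_le_add (Real.exp_le_exp.mpr (T.le_sup' (fun i => A i + l i) hi))
      (Real.exp_le_exp.mpr (T.le_sup' (fun i => A i - l i) hj))
  · rw [add_comm]
    exact add_le_add (Real.exp_le_exp.mpr (T.le_sup' (fun i => A i + l i) hj))
      (Real.exp_le_exp.mpr (T.le_sup' (fun i => A i - l i) hi))

lemma exp_half_add_le (a b : ℝ) :
    Real.exp ((a + b) / 2) ≤ (Real.exp a + Real.exp b) / 2 := by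
  have h := sq_nonneg (Real.exp (a / 2) - Real.exp (b / 2))
  have e1 : Real.exp a = Real.exp (a / 2) * Real.exp (a / 2) := by rw [← Real.exp_add]; ring_nf
  have e2 : Real.exp b = Real.exp (b / 2) * Real.exp (b / 2) := by rw [← Real.exp_add]; ring_nf
  have e3 : Real.exp ((a + b) / 2) = Real.exp (a / 2) * Real.exp (b / 2) := by
    rw [← Real.exp_add]; ring_nf
  rw [e1, e2, e3]
  nlinarith

lemma exp_sup'_half_add_le (T : Finset ι) (hT : T.Nonempty) (a b : ι → ℝ) :
    Real.exp (T.sup' hT fun i => (a i + b i) / 2) ≤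
      (Real.exp (T.sup' hT a) + Real.exp (T.sup' hT b)) / 2 := by
  refine le_trans (Real.exp_le_exp.mpr ?_) (exp_half_add_le _ _)
  refine T.sup'_le hT _ fun i hi => ?_
  have h1 := T.le_sup' a hi
  have h2 := T.le_sup' b hi
  linarith

variable {Ω : Type*} [MeasurableSpace Ω]

lemma measurable_exp_sup' (T : Finset ι) (hT : T.Nonempty) {f : ι → Ω → ℝ}
    (hf : ∀ i, Measurable (f i)) :
    Measurable fun z => Real.exp (T.sup' hT fun i => f i z) := by
  have h := Finset.measurable_sup' hT (f := f) fun i _ => hf i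
  have e : (fun z => T.sup' hT fun i => f i z) = T.sup' hT f := by
    funext z
    rw [Finset.sup'_apply]
  exact Real.measurable_exp.comp (e ▸ h)

lemma integrable_exp_sup' (ρ : Measure Ω) [IsFiniteMeasure ρ] (T : Finset ι) (hT : T.Nonempty)
    {f : ι → Ω → ℝ} (hf : ∀ i, Measurable (f i)) (hb : ∀ i, ∃ K, ∀ z, |f i z| ≤ K) :
    Integrable (fun z => Real.exp (T.sup' hT fun i => f i z)) ρ := by
  choose K hK using hb
  refine Integrable.of_bound (measurable_exp_sup' T hT hf).aestronglyMeasurable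
    (Real.exp (T.sup' hT K)) (Filter.Eventually.of_forall fun z => ?_)
  rw [Real.norm_of_nonneg (Real.exp_pos _).le]
  exact Real.exp_le_exp.mpr (Finset.sup'_mono_fun fun i _ => (abs_le.mp (hK i z)).2)

/-- Symmetrization and contraction in one coordinate. -/
lemma integral_exp_sup'_centered_le (ρ : Measure Ω) [IsProbabilityMeasure ρ] (T : Finset ι)
    (hT : T.Nonempty) (B : ι → ℝ) {g l : ι → Ω → ℝ} (hgm : ∀ i, Measurable (g i))
    (hlm : ∀ i, Measurable (l i)) (hlb : ∀ i, ∃ K, ∀ z, |l i z| ≤ K)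
    (h1 : ∀ i z, |g i z| ≤ |l i z|) (h2 : ∀ i j z, |g i z - g j z| ≤ |l i z - l j z|) :
    ∫ z, Real.exp (T.sup' hT fun i => B i + (∫ z', g i z' ∂ρ - g i z)) ∂ρ ≤
      ∫ z, (Real.exp (T.sup' hT fun i => B i + 2 * l i z) +
        Real.exp (T.sup' hT fun i => B i - 2 * l i z)) / 2 ∂ρ := by
  have hgb : ∀ i, ∃ K, ∀ z, |g i z| ≤ K := fun i =>
    (hlb i).imp fun K hK z => (h1 i z).trans (hK z)
  have hgi : ∀ i, Integrable (g i) ρ := fun i => by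
    obtain ⟨K, hK⟩ := hgb i
    exact Integrable.of_bound (hgm i).aestronglyMeasurable K (Filter.Eventually.of_forall hK)
  have bp : ∀ (c : ℝ) (f : ι → Ω → ℝ), (∀ i, ∃ K, ∀ z, |f i z| ≤ K) →
      ∀ i, ∃ K, ∀ z, |B i + c * f i z| ≤ K := fun c f hf i => by
    obtain ⟨K, hK⟩ := hf i
    refine ⟨|B i| + |c| * K, fun z => (abs_add_le _ _).trans ?_⟩
    rw [abs_mul]
    gcongr
    exact hK z
  have mp : ∀ (c : ℝ) (f : ι → Ω → ℝ), (∀ i, Measurable (f i)) →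
      ∀ i, Measurable fun z => B i + c * f i z := fun c f hf i =>
    ((hf i).const_mul c).const_add (B i)
  have iG : ∀ c : ℝ, Integrable (fun z => Real.exp (T.sup' hT fun i => B i + c * g i z)) ρ :=
    fun c => integrable_exp_sup' ρ T hT (mp c g hgm) (bp c g hgb)
  have iL : ∀ c : ℝ, Integrable (fun z => Real.exp (T.sup' hT fun i => B i + c * l i z)) ρ :=
    fun c => integrable_exp_sup' ρ T hT (mp c l hlm) (bp c l hlb)
  have step1 : ∀ z, Real.exp (T.sup' hT fun i => B i + (∫ z', g i z' ∂ρ - g i z)) ≤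
      ((∫ z', Real.exp (T.sup' hT fun i => B i + 2 * g i z') ∂ρ) +
        Real.exp (T.sup' hT fun i => B i + (-2) * g i z)) / 2 := by
    intro z
    -- The exponent is the midpoint of `B + 2 E g` and `B - 2 g(z)`. Convexity separates the two and
    -- Jensen moves the expectation outside, so both signs end up integrated over the same `z` and
    -- no independent copy of the sample is needed.
    have e : (fun i => B i + (∫ z', g i z' ∂ρ - g i z)) =
        fun i => ((∫ z', (B i + 2 * g i z') ∂ρ) + (B i + (-2) * g i z)) / 2 := by
      funext i
      rw [integral_add (integrable_const _) ((hgi i).const_mul 2), integral_const_mul]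
      simp
      ring
    rw [e]
    refine (exp_sup'_half_add_le T hT _ _).trans ?_
    gcongr
    obtain ⟨i, hi, hi'⟩ := T.exists_mem_eq_sup' hT fun i => ∫ z', (B i + 2 * g i z') ∂ρ
    rw [hi']
    have j1 : Integrable (fun z' => B i + 2 * g i z') ρ :=
      (integrable_const _).add ((hgi i).const_mul 2)
    have j2 : Integrable (fun z' => Real.exp (B i + 2 * g i z')) ρ := by
      obtain ⟨K, hK⟩ := bp 2 g hgb i
      refine Integrable.of_bound (Real.measurable_exp.comp (mp 2 g hgm i)).aestronglyMeasurable
        (Real.exp K) (Filter.Eventually.of_forall fun z' => ?_)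
      rw [Real.norm_of_nonneg (Real.exp_pos _).le]
      exact Real.exp_le_exp.mpr (abs_le.mp (hK z')).2
    refine (convexOn_exp.map_integral_le Real.continuous_exp.continuousOn isClosed_univ
      (Filter.Eventually.of_forall fun _ => Set.mem_univ _) j1 j2).trans ?_
    refine integral_mono j2 (iG 2) fun z' => ?_
    exact Real.exp_le_exp.mpr (T.le_sup' (fun i => B i + 2 * g i z') hi)
  have iC : Integrable (fun z => Real.exp (T.sup' hT fun i => B i + (∫ z', g i z' ∂ρ - g i z))) ρ := by
    refine integrable_exp_sup' ρ T hT (fun i => ((hgm i).const_sub _).const_add _) fun i => ?_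
    obtain ⟨K, hK⟩ := hgb i
    refine ⟨|B i| + (|∫ z', g i z' ∂ρ| + K), fun z => (abs_add_le _ _).trans ?_⟩
    gcongr
    exact (abs_sub _ _).trans (by gcongr; exact hK z)
  calc _ ≤ ∫ z, ((∫ z', Real.exp (T.sup' hT fun i => B i + 2 * g i z') ∂ρ) +
        Real.exp (T.sup' hT fun i => B i + (-2) * g i z)) / 2 ∂ρ :=
      integral_mono iC (((integrable_const _).add (iG (-2))).div_const 2) step1
    _ = ∫ z, (Real.exp (T.sup' hT fun i => B i + 2 * g i z) +
        Real.exp (T.sup' hT fun i => B i + (-2) * g i z)) / 2 ∂ρ := by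
      rw [integral_div, integral_div, integral_add (integrable_const _) (iG (-2)),
        integral_add (iG 2) (iG (-2))]
      simp
    _ ≤ ∫ z, (Real.exp (T.sup' hT fun i => B i + 2 * l i z) +
        Real.exp (T.sup' hT fun i => B i + (-2) * l i z)) / 2 ∂ρ := by
      refine integral_mono (((iG 2).add (iG (-2))).div_const 2)
        (((iL 2).add (iL (-2))).div_const 2) fun z => ?_
      have := exp_sup'_contraction T hT B (fun i => 2 * g i z) (fun i => 2 * l i z)
        (fun i => by simp only [abs_mul]; exact mul_le_mul_of_nonneg_left (h1 i z) (abs_nonneg _))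
        (fun i j => by
          simp only [← mul_sub, abs_mul]
          exact mul_le_mul_of_nonneg_left (h2 i j z) (abs_nonneg _))
      simp only [neg_mul, ← sub_eq_add_neg]
      linarith
    _ = _ := by simp only [neg_mul, ← sub_eq_add_neg]

/-- The law of a sample splits into the law of the first point and that of the others. -/
lemma lintegral_pi_succ (ρ : Measure Ω) [SigmaFinite ρ] {n : ℕ} {F : (Fin (n + 1) → Ω) → ℝ≥0∞}
    (hF : Measurable F) :
    ∫⁻ S, F S ∂(Measure.pi fun _ : Fin (n + 1) => ρ) =
      ∫⁻ S, ∫⁻ z, F (Fin.cons z S) ∂ρ ∂(Measure.pi fun _ : Fin n => ρ) := by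
  have h := (measurePreserving_piFinSuccAbove (fun _ : Fin (n + 1) => ρ) 0).symm
  rw [← h.lintegral_comp hF, lintegral_prod_symm]
  · simp [MeasurableEquiv.piFinSuccAbove_symm_apply, Fin.insertNthEquiv]
  · exact (hF.comp h.measurable).aemeasurable

end Concentration

/-! ### Penalized uniform deviations in a Hilbert space -/

section Deviation

variable {ι Ω E : Type*} [MeasurableSpace Ω] [NormedAddCommGroup E] [InnerProductSpace ℝ E]

/-- Averaging over the sign turns the cross term into a hyperbolic cosine, and `cosh x ≤ exp (x²/2)`
makes it quadratic in `‖u‖`. -/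
lemma exp_sq_norm_symmetric_le {β t : ℝ} (hβ : 0 ≤ β) (u v : E) (hv : ‖v‖ ^ 2 ≤ t) :
    (Real.exp (β * ‖u + v‖ ^ 2) + Real.exp (β * ‖u - v‖ ^ 2)) / 2 ≤
      Real.exp ((β + 2 * β ^ 2 * t) * ‖u‖ ^ 2 + β * t) := by
  have h1 : Real.exp (β * ‖u + v‖ ^ 2) =
      Real.exp (β * (‖u‖ ^ 2 + ‖v‖ ^ 2)) * Real.exp (2 * β * inner ℝ u v) := by
    rw [← Real.exp_add, norm_add_sq_real]; ring_nf
  have h2 : Real.exp (β * ‖u - v‖ ^ 2) =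
      Real.exp (β * (‖u‖ ^ 2 + ‖v‖ ^ 2)) * Real.exp (-(2 * β * inner ℝ u v)) := by
    rw [← Real.exp_add, norm_sub_sq_real]; ring_nf
  have h3 := Real.cosh_le_exp_half_sq (2 * β * inner ℝ u v)
  rw [Real.cosh_eq] at h3
  have h4 : (inner ℝ u v) ^ 2 ≤ ‖u‖ ^ 2 * t := by
    have := abs_real_inner_le_norm u v
    calc (inner ℝ u v) ^ 2 = |inner ℝ u v| ^ 2 := (sq_abs _).symm
      _ ≤ (‖u‖ * ‖v‖) ^ 2 := by gcongr
      _ = ‖u‖ ^ 2 * ‖v‖ ^ 2 := by ring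
      _ ≤ _ := by gcongr
  calc _ = Real.exp (β * (‖u‖ ^ 2 + ‖v‖ ^ 2)) *
        ((Real.exp (2 * β * inner ℝ u v) + Real.exp (-(2 * β * inner ℝ u v))) / 2) := by
        rw [h1, h2]; ring
    _ ≤ Real.exp (β * (‖u‖ ^ 2 + ‖v‖ ^ 2)) * Real.exp ((2 * β * inner ℝ u v) ^ 2 / 2) := by
        gcongr
    _ ≤ _ := by
        rw [← Real.exp_add, Real.exp_le_exp]
        have h5 : β ^ 2 * (inner ℝ u v) ^ 2 ≤ β ^ 2 * (‖u‖ ^ 2 * t) := by gcongr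
        have h6 : β * ‖v‖ ^ 2 ≤ β * t := by gcongr
        nlinarith

lemma lintegral_exp_sup'_centered_le (ρ : Measure Ω) [IsProbabilityMeasure ρ] (T : Finset ι)
    (hT : T.Nonempty) (B : ι → ℝ) {g l : ι → Ω → ℝ} (hgm : ∀ i, Measurable (g i))
    (hlm : ∀ i, Measurable (l i)) (hlb : ∀ i, ∃ K, ∀ z, |l i z| ≤ K)
    (h1 : ∀ i z, |g i z| ≤ |l i z|) (h2 : ∀ i j z, |g i z - g j z| ≤ |l i z - l j z|) :
    ∫⁻ z, ENNReal.ofReal (Real.exp (T.sup' hT fun i => B i + (∫ z', g i z' ∂ρ - g i z))) ∂ρ ≤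
      ∫⁻ z, (ENNReal.ofReal (Real.exp (T.sup' hT fun i => B i + 2 * l i z)) +
        ENNReal.ofReal (Real.exp (T.sup' hT fun i => B i + (-2) * l i z))) / 2 ∂ρ := by
  have key := integral_exp_sup'_centered_le ρ T hT B hgm hlm hlb h1 h2
  have iL : ∀ c : ℝ, Integrable
      (fun z => Real.exp (T.sup' hT fun i => B i + c * l i z)) ρ := fun c => by
    refine integrable_exp_sup' ρ T hT (fun i => ((hlm i).const_mul c).const_add _) fun i => ?_
    obtain ⟨K, hK⟩ := hlb i
    refine ⟨|B i| + |c| * K, fun z => (abs_add_le _ _).trans ?_⟩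
    rw [abs_mul]
    gcongr
    exact hK z
  have iG : Integrable
      (fun z => Real.exp (T.sup' hT fun i => B i + (∫ z', g i z' ∂ρ - g i z))) ρ := by
    refine integrable_exp_sup' ρ T hT (fun i => ((hgm i).const_sub _).const_add _) fun i => ?_
    obtain ⟨K, hK⟩ := hlb i
    refine ⟨|B i| + (|∫ z', g i z' ∂ρ| + K), fun z => (abs_add_le _ _).trans ?_⟩
    gcongr
    exact (abs_sub _ _).trans (by gcongr; exact (h1 i z).trans (hK z))
  calc _ = ENNReal.ofReal (∫ z, Real.exp
        (T.sup' hT fun i => B i + (∫ z', g i z' ∂ρ - g i z)) ∂ρ) :=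
        (ofReal_integral_eq_lintegral_ofReal iG
          (Filter.Eventually.of_forall fun _ => (Real.exp_pos _).le)).symm
    _ ≤ ENNReal.ofReal (∫ z, (Real.exp (T.sup' hT fun i => B i + 2 * l i z) +
          Real.exp (T.sup' hT fun i => B i + (-2) * l i z)) / 2 ∂ρ) := by
        refine ENNReal.ofReal_le_ofReal (key.trans (le_of_eq ?_))
        simp only [neg_mul, ← sub_eq_add_neg]
    _ = ∫⁻ z, ENNReal.ofReal ((Real.exp (T.sup' hT fun i => B i + 2 * l i z) +
          Real.exp (T.sup' hT fun i => B i + (-2) * l i z)) / 2) ∂ρ :=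
        ofReal_integral_eq_lintegral_ofReal (((iL 2).add (iL (-2))).div_const 2)
          (Filter.Eventually.of_forall fun _ => by positivity)
    _ = _ := by
        refine lintegral_congr fun z => ?_
        rw [ENNReal.ofReal_div_of_pos two_pos, ENNReal.ofReal_add (Real.exp_pos _).le
          (Real.exp_pos _).le, ENNReal.ofReal_ofNat]

/-- The form of the bound that iterates: the growth `β ↦ β + 2β²t` of the coefficient `β = 1/q` is
dominated by `1/(q - 2t)`, so each sample point lowers the denominator by a fixed amount. -/
lemma exp_average_step_le {q t : ℝ} (c : ℝ) (hq' : 0 < q - 2 * t) (ht : 0 ≤ t) (hc : 0 ≤ c)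
    (u v : E) (hv : ‖v‖ ^ 2 ≤ t) :
    (Real.exp ((‖u + v‖ ^ 2 + t * c) / q) + Real.exp ((‖u - v‖ ^ 2 + t * c) / q)) / 2 ≤
      Real.exp ((‖u‖ ^ 2 + t * (c + 1)) / (q - 2 * t)) := by
  have hq0 : 0 < q := by linarith
  have h3 := exp_sq_norm_symmetric_le (inv_nonneg.mpr hq0.le) u v hv
  have e1 : ∀ x : ℝ, Real.exp ((x + t * c) / q) =
      Real.exp (q⁻¹ * x) * Real.exp (q⁻¹ * (t * c)) := fun x => by
    rw [← Real.exp_add]; congr 1; field_simp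
  rw [e1, e1, ← add_mul, mul_div_right_comm]
  refine (mul_le_mul_of_nonneg_right h3 (Real.exp_pos _).le).trans ?_
  rw [← Real.exp_add, Real.exp_le_exp]
  have hp : q⁻¹ + 2 * q⁻¹ ^ 2 * t ≤ (q - 2 * t)⁻¹ := by
    rw [← sub_nonneg]
    have : (q - 2 * t)⁻¹ - (q⁻¹ + 2 * q⁻¹ ^ 2 * t) = (2 * t) ^ 2 / (q ^ 2 * (q - 2 * t)) := by
      have := hq'.ne'
      field_simp
      ring
    rw [this]
    positivity
  have hp' : q⁻¹ ≤ (q - 2 * t)⁻¹ := inv_anti₀ hq' (by linarith)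
  calc _ = (q⁻¹ + 2 * q⁻¹ ^ 2 * t) * ‖u‖ ^ 2 + q⁻¹ * (t * (c + 1)) := by ring
    _ ≤ (q - 2 * t)⁻¹ * ‖u‖ ^ 2 + (q - 2 * t)⁻¹ * (t * (c + 1)) := by gcongr
    _ = _ := by rw [← mul_add, div_eq_inv_mul]

/-- Exponential moment of the supremum of a centered empirical process with a quadratic penalty,
for functions that are contractions of linear functions on a Hilbert space. -/
theorem lintegral_exp_sup'_deviation_le (ρ : Measure Ω) [IsProbabilityMeasure ρ] (T : Finset ι)
    (hT : T.Nonempty) (W : ι → E) {g : ι → Ω → ℝ} {φ : Ω → E} {b m : ℝ} (hm : 0 ≤ m)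
    (hgm : ∀ i, Measurable (g i)) (hφm : ∀ v : E, Measurable fun z => inner ℝ v (φ z))
    (hφ : ∀ z, ‖φ z‖ ≤ 1) (h1 : ∀ i z, |g i z| ≤ m * |inner ℝ (W i) (φ z)|)
    (h2 : ∀ i j z, |g i z - g j z| ≤ m * |inner ℝ (W i) (φ z) - inner ℝ (W j) (φ z)|) (n : ℕ) :
    0 < 4 * b - 8 * m ^ 2 * n → ∀ u : E,
    ∫⁻ S, ENNReal.ofReal (Real.exp (T.sup' hT fun i => inner ℝ (W i) u - b * ‖W i‖ ^ 2 +
        ∑ k, (∫ z, g i z ∂ρ - g i (S k)))) ∂(Measure.pi fun _ : Fin n => ρ) ≤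
      ENNReal.ofReal (Real.exp ((‖u‖ ^ 2 + 4 * m ^ 2 * n) / (4 * b - 8 * m ^ 2 * n))) := by
  induction n with
  | zero =>
    intro hb u
    simp only [Finset.univ_eq_empty, Finset.sum_empty, add_zero, lintegral_const, measure_univ,
      mul_one, Nat.cast_zero, mul_zero, sub_zero] at hb ⊢
    refine ENNReal.ofReal_le_ofReal (Real.exp_le_exp.mpr (T.sup'_le hT _ fun i _ => ?_))
    rw [le_div_iff₀ hb]
    have := real_inner_le_norm (W i) u
    -- Completing the square: `⟨W, u⟩ - b‖W‖² ≤ ‖u‖²/(4b)`.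
    nlinarith [sq_nonneg (2 * b * ‖W i‖ - ‖u‖)]
  | succ n ih =>
    intro hb u
    push_cast at hb
    set q := 4 * b - 8 * m ^ 2 * (n : ℝ) with hq
    have hq' : 0 < q - 8 * m ^ 2 := by linarith
    have hq0 : 0 < q := by nlinarith [sq_nonneg m]
    set l : ι → Ω → ℝ := fun i z => m * inner ℝ (W i) (φ z) with hl
    have hlm : ∀ i, Measurable (l i) := fun i => (hφm (W i)).const_mul m
    have hlb : ∀ i, ∃ K, ∀ z, |l i z| ≤ K := fun i => by
      refine ⟨m * ‖W i‖, fun z => ?_⟩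
      rw [hl, abs_mul, abs_of_nonneg hm]
      refine mul_le_mul_of_nonneg_left ((abs_real_inner_le_norm _ _).trans ?_) hm
      exact mul_le_of_le_one_right (norm_nonneg _) (hφ z)
    have hgb : ∀ i, ∃ K, ∀ z, |g i z| ≤ K := fun i =>
      (hlb i).imp fun K hK z => (h1 i z).trans (by
        have := hK z
        rwa [hl, abs_mul, abs_of_nonneg hm] at this)
    obtain ⟨G, hG⟩ : ∃ G : ℝ → (Fin n → Ω) → Ω → ℝ≥0∞, ∀ c S z, G c S z =
        ENNReal.ofReal (Real.exp (T.sup' hT fun i => inner ℝ (W i) u - b * ‖W i‖ ^ 2 +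
          ∑ k, (∫ z, g i z ∂ρ - g i (S k)) + c * l i z)) := ⟨_, fun _ _ _ => rfl⟩
    have meas : ∀ c : ℝ, Measurable fun p : (Fin n → Ω) × Ω => G c p.1 p.2 := fun c => by
      simp only [hG]
      refine ENNReal.measurable_ofReal.comp (measurable_exp_sup' T hT fun i => ?_)
      refine Measurable.add (Measurable.const_add (Finset.measurable_sum _ fun k _ => ?_) _)
        (((hlm i).comp measurable_snd).const_mul c)
      exact ((hgm i).comp ((measurable_pi_apply k).comp measurable_fst)).const_sub _
    have one : ∀ S : Fin n → Ω,
        ∫⁻ z, ENNReal.ofReal (Real.exp (T.sup' hT fun i => inner ℝ (W i) u - b * ‖W i‖ ^ 2 +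
          ∑ k, (∫ z, g i z ∂ρ - g i ((Fin.cons z S : Fin (n + 1) → Ω) k)))) ∂ρ ≤
        ∫⁻ z, (G 2 S z + G (-2) S z) / 2 ∂ρ := fun S => by
      simp only [hG]
      refine le_of_eq_of_le (lintegral_congr fun z => ?_)
        (lintegral_exp_sup'_centered_le ρ T hT (fun i => inner ℝ (W i) u - b * ‖W i‖ ^ 2 +
          ∑ k, (∫ z, g i z ∂ρ - g i (S k))) hgm hlm hlb
        (fun i z => by rw [hl, abs_mul, abs_of_nonneg hm]; exact h1 i z)
        (fun i j z => by
          simp only [hl]; rw [← mul_sub, abs_mul, abs_of_nonneg hm]; exact h2 i j z))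
      congr 3
      funext i
      rw [Fin.sum_univ_succ]
      simp only [Fin.cons_zero, Fin.cons_succ]
      ring
    -- The signed linear term only shifts `u` by `c m φ(z)`; this is why the induction runs over all
    -- `u`.
    have fold : ∀ (c : ℝ) (z : Ω), ∫⁻ S, G c S z ∂(Measure.pi fun _ : Fin n => ρ) ≤
        ENNReal.ofReal (Real.exp ((‖u + (c * m) • φ z‖ ^ 2 + 4 * m ^ 2 * n) / q)) := fun c z => by
      simp only [hG]
      refine le_of_eq_of_le (lintegral_congr fun S => ?_) (ih hq0 (u + (c * m) • φ z))
      congr 3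
      funext i
      rw [inner_add_right, real_inner_smul_right]
      simp only [hl]
      ring
    rw [lintegral_pi_succ]
    swap
    · refine ENNReal.measurable_ofReal.comp (measurable_exp_sup' T hT fun i => ?_)
      refine Measurable.const_add (Finset.measurable_sum _ fun k _ => ?_) _
      exact ((hgm i).comp (measurable_pi_apply k)).const_sub _
    refine (lintegral_mono one).trans ?_
    -- With the remaining sample integrated first, the induction hypothesis applies at fixed `z`,
    -- and the two signs are averaged afterwards.
    rw [lintegral_lintegral_swap (((meas 2).add (meas (-2))).div_const 2).aemeasurable]
    have bound : ∀ z, ∫⁻ S, (G 2 S z + G (-2) S z) / 2 ∂(Measure.pi fun _ : Fin n => ρ) ≤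
        ENNReal.ofReal (Real.exp ((‖u‖ ^ 2 + 4 * m ^ 2 * (n + 1)) / (q - 2 * (4 * m ^ 2)))) := by
      intro z
      have mm : ∀ c : ℝ, Measurable fun S => G c S z := fun c =>
        (meas c).comp (measurable_id.prodMk measurable_const)
      simp only [div_eq_mul_inv (_ + _) (2 : ℝ≥0∞)]
      rw [lintegral_mul_const _ (show Measurable fun S => G 2 S z + G (-2) S z from
        (mm 2).add (mm (-2))), lintegral_add_left (mm 2),
        ← div_eq_mul_inv]
      refine (ENNReal.div_le_div_right (add_le_add (fold 2 z) (fold (-2) z)) 2).trans ?_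
      rw [← ENNReal.ofReal_add (Real.exp_pos _).le (Real.exp_pos _).le,
        ← ENNReal.ofReal_ofNat, ← ENNReal.ofReal_div_of_pos two_pos]
      refine ENNReal.ofReal_le_ofReal ?_
      have hv : ‖(2 * m) • φ z‖ ^ 2 ≤ 4 * m ^ 2 := by
        rw [norm_smul, Real.norm_of_nonneg (by positivity)]
        have := mul_le_of_le_one_right (by positivity : 0 ≤ 2 * m) (hφ z)
        calc _ ≤ (2 * m) ^ 2 := by gcongr
          _ = _ := by ring
      rw [show u + (-2 * m) • φ z = u - (2 * m) • φ z by rw [neg_mul, neg_smul, sub_eq_add_neg]]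
      exact exp_average_step_le _ (by linarith) (by positivity) (Nat.cast_nonneg n) u _ hv
    refine (lintegral_mono bound).trans (le_of_eq ?_)
    rw [lintegral_const, measure_univ, mul_one]
    push_cast
    rw [hq]
    congr 3
    ring

/-- Uniform deviation of the means of a countable family of functions that are contractions of
linear functions on a Hilbert space, up to a quadratic penalty. -/
theorem measure_exists_deviation_le [Countable ι] (ρ : Measure Ω) [IsProbabilityMeasure ρ]
    (W : ι → E) {g : ι → Ω → ℝ} {φ : Ω → E} {b M t : ℝ} (hM : 0 < M) (hb : 0 < b)
    (hgm : ∀ i, Measurable (g i)) (hφm : ∀ v : E, Measurable fun z => inner ℝ v (φ z))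
    (hφ : ∀ z, ‖φ z‖ ≤ 1) (h1 : ∀ i z, |g i z| ≤ M * |inner ℝ (W i) (φ z)|)
    (h2 : ∀ i j z, |g i z - g j z| ≤ M * |inner ℝ (W i) (φ z) - inner ℝ (W j) (φ z)|) {n : ℕ}
    (hn : 0 < n) :
    (Measure.pi fun _ : Fin n => ρ) {S | ∃ i, b * ‖W i‖ ^ 2 + t ≤
        ∫ z, g i z ∂ρ - (1 / (n : ℝ)) * ∑ k, g i (S k)} ≤
      ENNReal.ofReal (Real.exp (1 / 2 - b * n * t / (4 * M ^ 2))) := by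
  have hn' : (0 : ℝ) < n := Nat.cast_pos.mpr hn
  -- Chernoff parameter: the moment bound then has numerator `b²n/(4M²)` and denominator
  -- `b²n/(2M²)`, hence the value `exp (1/2)`.
  set s : ℝ := b / (4 * M ^ 2) with hs
  have hs0 : 0 < s := by positivity
  have fin : ∀ T : Finset ι, (Measure.pi fun _ : Fin n => ρ) {S | ∃ i ∈ T, b * ‖W i‖ ^ 2 + t ≤
        ∫ z, g i z ∂ρ - (1 / (n : ℝ)) * ∑ k, g i (S k)} ≤
      ENNReal.ofReal (Real.exp (1 / 2 - b * n * t / (4 * M ^ 2))) := by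
    intro T
    rcases T.eq_empty_or_nonempty with rfl | hT
    · simp
    have main := lintegral_exp_sup'_deviation_le ρ T hT W (g := fun i z => s * g i z) (φ := φ)
      (b := s * n * b) (m := s * M) (by positivity) (fun i => (hgm i).const_mul s) hφm hφ
      (fun i z => by
        rw [abs_mul, abs_of_pos hs0, mul_assoc]
        exact mul_le_mul_of_nonneg_left (h1 i z) hs0.le)
      (fun i j z => by
        rw [← mul_sub, abs_mul, abs_of_pos hs0, mul_assoc]
        exact mul_le_mul_of_nonneg_left (h2 i j z) hs0.le) n
      (by
        have : 4 * (s * n * b) - 8 * (s * M) ^ 2 * n = b ^ 2 * n / (2 * M ^ 2) := by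
          rw [hs]; field_simp; ring
        rw [this]; positivity) 0
    have val : (‖(0 : E)‖ ^ 2 + 4 * (s * M) ^ 2 * n) / (4 * (s * n * b) - 8 * (s * M) ^ 2 * n) =
        1 / 2 := by
      have e1 : 4 * (s * n * b) - 8 * (s * M) ^ 2 * n = b ^ 2 * n / (2 * M ^ 2) := by
        rw [hs]; field_simp; ring
      rw [e1, hs, norm_zero]
      field_simp
      ring
    rw [val] at main
    set c : ℝ := b * n * t / (4 * M ^ 2) with hc
    have hc' : c = s * n * t := by rw [hc, hs]; ring
    have sub : {S : Fin n → Ω | ∃ i ∈ T, b * ‖W i‖ ^ 2 + t ≤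
        ∫ z, g i z ∂ρ - (1 / (n : ℝ)) * ∑ k, g i (S k)} ⊆
        {S | ENNReal.ofReal (Real.exp c) ≤ ENNReal.ofReal (Real.exp (T.sup' hT fun i =>
          inner ℝ (W i) 0 - s * n * b * ‖W i‖ ^ 2 + ∑ k, (∫ z, s * g i z ∂ρ - s * g i (S k))))} := by
      rintro S ⟨i, hi, hS⟩
      refine ENNReal.ofReal_le_ofReal (Real.exp_le_exp.mpr ?_)
      refine le_trans ?_ (T.le_sup' (fun i => inner ℝ (W i) 0 - s * n * b * ‖W i‖ ^ 2 +
        ∑ k, (∫ z, s * g i z ∂ρ - s * g i (S k))) hi)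
      have h3 := mul_le_mul_of_nonneg_left hS (by positivity : 0 ≤ s * n)
      have e2 : s * n * (∫ z, g i z ∂ρ - (1 / (n : ℝ)) * ∑ k, g i (S k)) =
          ∑ k, (∫ z, s * g i z ∂ρ - s * g i (S k)) := by
        rw [Finset.sum_sub_distrib, ← Finset.mul_sum, integral_const_mul]
        simp
        field_simp
      rw [e2] at h3
      rw [inner_zero_right, hc']
      linarith
    have hpos : ENNReal.ofReal (Real.exp c) ≠ 0 := by
      simpa using Real.exp_pos c
    have meas : Measurable fun S : Fin n → Ω => ENNReal.ofReal (Real.exp (T.sup' hT fun i =>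
        inner ℝ (W i) 0 - s * n * b * ‖W i‖ ^ 2 + ∑ k, (∫ z, s * g i z ∂ρ - s * g i (S k)))) := by
      refine ENNReal.measurable_ofReal.comp (measurable_exp_sup' T hT fun i => ?_)
      refine Measurable.const_add (Finset.measurable_sum _ fun k _ => ?_) _
      exact (((hgm i).comp (measurable_pi_apply k)).const_mul s).const_sub _
    refine (measure_mono sub).trans ((meas_ge_le_lintegral_div meas.aemeasurable hpos
      ENNReal.ofReal_ne_top).trans ?_)
    refine (ENNReal.div_le_div_right main _).trans (le_of_eq ?_)
    rw [← ENNReal.ofReal_div_of_pos (Real.exp_pos _), ← Real.exp_sub]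
  -- The finite bound does not depend on `T`, so it passes to the increasing union over finite
  -- subsets.
  have eq : {S : Fin n → Ω | ∃ i, b * ‖W i‖ ^ 2 + t ≤
        ∫ z, g i z ∂ρ - (1 / (n : ℝ)) * ∑ k, g i (S k)} =
      ⋃ T : Finset ι, {S | ∃ i ∈ T, b * ‖W i‖ ^ 2 + t ≤
        ∫ z, g i z ∂ρ - (1 / (n : ℝ)) * ∑ k, g i (S k)} := by
    ext S
    simp only [Set.mem_ofPred_eq, Set.mem_iUnion]
    constructor
    · rintro ⟨i, hi⟩
      exact ⟨{i}, i, Finset.mem_singleton_self i, hi⟩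
    · rintro ⟨T, i, _, hi⟩
      exact ⟨i, hi⟩
  rw [eq, Monotone.measure_iUnion]
  · exact iSup_le fin
  · intro T₁ T₂ h S
    rintro ⟨i, hi, hS⟩
    exact ⟨i, h hi, hS⟩

end Deviation

/-! ### Bernstein inequality in a Hilbert space -/

section Bernstein

variable {Ω : Type*} [MeasurableSpace Ω]

/-- Iterates a one-step supermartingale estimate for the potential `Ψ` along independent increments.
-/
lemma lintegral_pi_sum_le {V : Type*} [AddCommMonoid V] [MeasurableSpace V] [MeasurableAdd₂ V]
    (P : Measure Ω) [SigmaFinite P] {Ψ : V → ℝ≥0∞} {ζ : Ω → V} (hΨ : Measurable Ψ)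
    (hζ : Measurable ζ) {K : ℝ≥0∞} (h : ∀ x, ∫⁻ ω, Ψ (x + ζ ω) ∂P ≤ K * Ψ x) (R : ℕ) (x : V) :
    ∫⁻ ω, Ψ (x + ∑ j, ζ (ω j)) ∂(Measure.pi fun _ : Fin R => P) ≤ K ^ R * Ψ x := by
  have meas : ∀ R : ℕ, Measurable fun ω : Fin R → Ω => Ψ (x + ∑ j, ζ (ω j)) := fun R =>
    hΨ.comp (Measurable.const_add
      (Finset.measurable_sum _ fun j _ => hζ.comp (measurable_pi_apply j)) x)
  induction R with
  | zero => simp [lintegral_const]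
  | succ R ih =>
    rw [lintegral_pi_succ P (meas (R + 1))]
    calc _ ≤ ∫⁻ ω, K * Ψ (x + ∑ j, ζ (ω j)) ∂(Measure.pi fun _ : Fin R => P) := by
          refine lintegral_mono fun ω => le_of_eq_of_le (lintegral_congr fun z => ?_)
            (h (x + ∑ j, ζ (ω j)))
          rw [Fin.sum_univ_succ]
          simp only [Fin.cons_zero, Fin.cons_succ]
          rw [add_comm (ζ z), add_assoc]
      _ = K * ∫⁻ ω, Ψ (x + ∑ j, ζ (ω j)) ∂(Measure.pi fun _ : Fin R => P) :=
          lintegral_const_mul _ (meas R)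
      _ ≤ K * (K ^ R * Ψ x) := by gcongr
      _ = _ := by ring

variable {V : Type*} [NormedAddCommGroup V] [InnerProductSpace ℝ V]

/-- The square root lies below its tangent at `N²`. This smooth substitute for the norm has a linear
term that averages to zero for centered increments. -/
lemma sqrt_sq_add_norm_add_sq_le {a : ℝ} (ha : 0 < a) (x v : V) :
    √(a ^ 2 + ‖x + v‖ ^ 2) ≤ √(a ^ 2 + ‖x‖ ^ 2) +
      inner ℝ x v / √(a ^ 2 + ‖x‖ ^ 2) + ‖v‖ ^ 2 / (2 * a) := by
  set N := √(a ^ 2 + ‖x‖ ^ 2) with hN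
  have hN2 : N ^ 2 = a ^ 2 + ‖x‖ ^ 2 := Real.sq_sqrt (by positivity)
  have haN : a ≤ N := Real.le_sqrt_of_sq_le (by nlinarith [sq_nonneg ‖x‖])
  have hN0 : 0 < N := ha.trans_le haN
  have h1 : ‖v‖ ^ 2 / (2 * N) ≤ ‖v‖ ^ 2 / (2 * a) := by gcongr
  refine le_trans ?_ (add_le_add_right h1 _)
  have h2 : N + inner ℝ x v / N + ‖v‖ ^ 2 / (2 * N) =
      (N ^ 2 + (a ^ 2 + ‖x + v‖ ^ 2)) / (2 * N) := by
    rw [norm_add_sq_real, show a ^ 2 + (‖x‖ ^ 2 + 2 * inner ℝ x v + ‖v‖ ^ 2) =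
      N ^ 2 + 2 * inner ℝ x v + ‖v‖ ^ 2 by rw [hN2]; ring]
    field_simp
    ring
  rw [h2, le_div_iff₀ (by positivity)]
  have h3 := Real.sq_sqrt (by positivity : 0 ≤ a ^ 2 + ‖x + v‖ ^ 2)
  nlinarith [sq_nonneg (√(a ^ 2 + ‖x + v‖ ^ 2) - N)]

/-- From `exp y ≤ 1 + y + y²` for `|y| ≤ 1`. The term `p` is kept exactly because it has mean zero
in the application; the rest is bounded by quantities with controlled mean, and `1/64 + 54/1000 ≤
7/100`. -/
lemma exp_le_of_bernstein {τ p e r y : ℝ} (hτ : 0 < τ) (hp : |p| ≤ e / (16 * τ))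
    (he0 : 0 ≤ e) (he : e ≤ 2 * τ) (hr0 : 0 ≤ r) (hr : r ≤ τ ^ 2)
    (hy : y = p + e ^ 2 / (512 * τ ^ 2) + 3 / (64 * τ ^ 2) * r) :
    Real.exp y ≤ 1 + p + (e ^ 2 / 64 + 54 / 1000 * r) / τ ^ 2 := by
  obtain ⟨E, hE⟩ : ∃ E, E = e / τ := ⟨_, rfl⟩
  obtain ⟨ρ, hρ⟩ : ∃ ρ, ρ = r / τ ^ 2 := ⟨_, rfl⟩
  have hE0 : 0 ≤ E := by rw [hE]; positivity
  have hE2 : E ≤ 2 := by rw [hE, div_le_iff₀ hτ]; exact he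
  have hρ0 : 0 ≤ ρ := by rw [hρ]; positivity
  have hρ1 : ρ ≤ 1 := by rw [hρ, div_le_iff₀ (by positivity), one_mul]; exact hr
  have hp' : |p| ≤ E / 16 := hp.trans (le_of_eq (by rw [hE]; field_simp))
  have hy' : y = p + E ^ 2 / 512 + 3 / 64 * ρ := by rw [hy, hE, hρ]; field_simp
  have goal' : (e ^ 2 / 64 + 54 / 1000 * r) / τ ^ 2 = E ^ 2 / 64 + 54 / 1000 * ρ := by
    rw [hE, hρ]; field_simp
  rw [goal']
  obtain ⟨hp1, hp2⟩ := abs_le.mp hp'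
  have hEE : E ^ 2 ≤ 2 * E := by nlinarith
  have hE4 : (E ^ 2) ^ 2 ≤ 4 * E ^ 2 := by nlinarith [sq_nonneg E]
  have hpp : p ^ 2 ≤ E ^ 2 / 256 := by
    calc p ^ 2 = |p| ^ 2 := (sq_abs p).symm
      _ ≤ (E / 16) ^ 2 := by gcongr
      _ = _ := by ring
  have hρρ : ρ ^ 2 ≤ ρ := by nlinarith
  have h1 : |y| ≤ 1 := by
    rw [abs_le, hy']
    constructor <;> nlinarith [sq_nonneg E]
  have h2 := (abs_le.mp (Real.abs_exp_sub_one_sub_id_le h1)).2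
  have h3 : y ^ 2 ≤ 3 * (p ^ 2 + (E ^ 2 / 512) ^ 2 + (3 / 64 * ρ) ^ 2) := by
    rw [hy']
    nlinarith [sq_nonneg (p - E ^ 2 / 512), sq_nonneg (p - 3 / 64 * ρ),
      sq_nonneg (E ^ 2 / 512 - 3 / 64 * ρ)]
  nlinarith

variable [MeasurableSpace V] [BorelSpace V] [SecondCountableTopology V]

/-- One step of the exponential supermartingale for Bernstein's inequality in a Hilbert space. -/
lemma lintegral_exp_bernstein_step_le (P : Measure Ω) [IsProbabilityMeasure P] {ξ : Ω → V}
    {r : Ω → ℝ} {τ σ : ℝ} (hτ : 0 < τ) (hξ : Measurable ξ) (hr : Measurable r)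
    (hξb : ∀ ω, ‖ξ ω‖ ≤ 2 * τ) (hr0 : ∀ ω, 0 ≤ r ω) (hrb : ∀ ω, r ω ≤ τ ^ 2)
    (hξ0 : ∀ x : V, ∫ ω, inner ℝ x (ξ ω) ∂P = 0) (hξσ : ∫ ω, ‖ξ ω‖ ^ 2 ∂P ≤ σ)
    (hrσ : ∫ ω, r ω ∂P ≤ σ) (x : V × ℝ) :
    ∫⁻ ω, ENNReal.ofReal (Real.exp (√((16 * τ) ^ 2 + ‖x.1 + ξ ω‖ ^ 2) / (16 * τ) +
        3 / (64 * τ ^ 2) * (x.2 + r ω))) ∂P ≤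
      ENNReal.ofReal (Real.exp (7 / 100 * σ / τ ^ 2)) *
        ENNReal.ofReal (Real.exp (√((16 * τ) ^ 2 + ‖x.1‖ ^ 2) / (16 * τ) +
          3 / (64 * τ ^ 2) * x.2)) := by
  set N := √((16 * τ) ^ 2 + ‖x.1‖ ^ 2) with hN
  have hxN : ‖x.1‖ ≤ N := Real.le_sqrt_of_sq_le (by nlinarith [sq_nonneg (16 * τ)])
  have hN0 : 0 < N := Real.sqrt_pos.mpr (by positivity)
  set p : Ω → ℝ := fun ω => inner ℝ x.1 (ξ ω) / (N * (16 * τ)) with hp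
  have hpb : ∀ ω, |p ω| ≤ ‖ξ ω‖ / (16 * τ) := fun ω => by
    rw [hp, abs_div, abs_of_pos (by positivity : 0 < N * (16 * τ)),
      div_le_div_iff₀ (by positivity) (by positivity)]
    have h1 := abs_real_inner_le_norm x.1 (ξ ω)
    have h2 : ‖x.1‖ * ‖ξ ω‖ ≤ N * ‖ξ ω‖ := by gcongr
    calc _ ≤ N * ‖ξ ω‖ * (16 * τ) := by gcongr; exact h1.trans h2
      _ = _ := by ring
  have pt : ∀ ω, Real.exp (√((16 * τ) ^ 2 + ‖x.1 + ξ ω‖ ^ 2) / (16 * τ) +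
        3 / (64 * τ ^ 2) * (x.2 + r ω)) ≤
      Real.exp (N / (16 * τ) + 3 / (64 * τ ^ 2) * x.2) *
        (1 + p ω + (‖ξ ω‖ ^ 2 / 64 + 54 / 1000 * r ω) / τ ^ 2) := fun ω => by
    have h1 := sqrt_sq_add_norm_add_sq_le (by positivity : 0 < 16 * τ) x.1 (ξ ω)
    have h2 := exp_le_of_bernstein hτ (hpb ω) (norm_nonneg _) (hξb ω) (hr0 ω) (hrb ω) rfl
    refine le_trans ?_ (mul_le_mul_of_nonneg_left h2 (Real.exp_pos _).le)
    rw [← Real.exp_add, Real.exp_le_exp]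
    have h3 := div_le_div_of_nonneg_right h1 (by positivity : 0 ≤ 16 * τ)
    have h4 : (N + inner ℝ x.1 (ξ ω) / N + ‖ξ ω‖ ^ 2 / (2 * (16 * τ))) / (16 * τ) =
        N / (16 * τ) + p ω + ‖ξ ω‖ ^ 2 / (512 * τ ^ 2) := by
      simp only [hp]
      field_simp
      ring
    rw [h4] at h3
    linarith
  have iξ : Integrable (fun ω => ‖ξ ω‖ ^ 2) P := by
    refine Integrable.of_bound (hξ.norm.pow_const 2).aestronglyMeasurable ((2 * τ) ^ 2)
      (Filter.Eventually.of_forall fun ω => ?_)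
    rw [Real.norm_of_nonneg (by positivity)]
    gcongr
    exact hξb ω
  have ir : Integrable r P := by
    refine Integrable.of_bound hr.aestronglyMeasurable (τ ^ 2)
      (Filter.Eventually.of_forall fun ω => ?_)
    rw [Real.norm_of_nonneg (hr0 ω)]
    exact hrb ω
  have ip : Integrable p P := by
    refine Integrable.of_bound ((hξ.const_inner).div_const _).aestronglyMeasurable
      (2 * τ / (16 * τ)) (Filter.Eventually.of_forall fun ω => (hpb ω).trans ?_)
    gcongr
    exact hξb ω
  have iD : Integrable (fun ω => (‖ξ ω‖ ^ 2 / 64 + 54 / 1000 * r ω) / τ ^ 2) P :=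
    ((iξ.div_const _).add (ir.const_mul _)).div_const _
  have i1 : Integrable (fun ω => 1 + p ω) P := (integrable_const 1).add ip
  have val : ∫ ω, (1 + p ω + (‖ξ ω‖ ^ 2 / 64 + 54 / 1000 * r ω) / τ ^ 2) ∂P ≤
      Real.exp (7 / 100 * σ / τ ^ 2) := by
    rw [integral_add i1 iD, integral_add (integrable_const 1) ip, integral_div, integral_div,
      integral_add (iξ.div_const _) (ir.const_mul _), integral_div, integral_const_mul, hξ0]
    refine le_trans ?_ (Real.add_one_le_exp _)
    have hσ : 0 ≤ σ := (integral_nonneg hr0).trans hrσ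
    simp only [integral_const, probReal_univ, smul_eq_mul, mul_one, zero_div, add_zero]
    rw [add_comm]
    gcongr
    linarith
  calc _ ≤ ∫⁻ ω, ENNReal.ofReal (Real.exp (N / (16 * τ) + 3 / (64 * τ ^ 2) * x.2) *
        (1 + p ω + (‖ξ ω‖ ^ 2 / 64 + 54 / 1000 * r ω) / τ ^ 2)) ∂P :=
        lintegral_mono fun ω => ENNReal.ofReal_le_ofReal (pt ω)
    _ = ENNReal.ofReal (∫ ω, Real.exp (N / (16 * τ) + 3 / (64 * τ ^ 2) * x.2) *
        (1 + p ω + (‖ξ ω‖ ^ 2 / 64 + 54 / 1000 * r ω) / τ ^ 2) ∂P) :=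
        (ofReal_integral_eq_lintegral_ofReal ((i1.add iD).const_mul _)
          (Filter.Eventually.of_forall fun ω => (Real.exp_pos _).le.trans (pt ω))).symm
    _ ≤ _ := by
        rw [integral_const_mul, ← ENNReal.ofReal_mul (Real.exp_pos _).le, mul_comm]
        exact ENNReal.ofReal_le_ofReal (mul_le_mul_of_nonneg_right val (Real.exp_pos _).le)

/-- A Bernstein inequality in a Hilbert space, jointly with a bound for nonnegative variables. -/
theorem measure_bernstein_le (P : Measure Ω) [IsProbabilityMeasure P] {ξ : Ω → V}
    {r : Ω → ℝ} {τ σ : ℝ} (hτ : 0 < τ) (hξ : Measurable ξ) (hr : Measurable r)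
    (hξb : ∀ ω, ‖ξ ω‖ ≤ 2 * τ) (hr0 : ∀ ω, 0 ≤ r ω) (hrb : ∀ ω, r ω ≤ τ ^ 2)
    (hξ0 : ∀ x : V, ∫ ω, inner ℝ x (ξ ω) ∂P = 0) (hξσ : ∫ ω, ‖ξ ω‖ ^ 2 ∂P ≤ σ)
    (hrσ : ∫ ω, r ω ∂P ≤ σ) (R : ℕ) :
    (Measure.pi fun _ : Fin R => P) {ω | ¬ (‖∑ j, ξ (ω j)‖ ≤ 3 * R * σ / τ ∧
        ∑ j, r (ω j) ≤ 4 * R * σ)} ≤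
      ENNReal.ofReal (Real.exp (1 - R * σ / τ ^ 2 / 10)) := by
  set Ψ : V × ℝ → ℝ≥0∞ := fun x => ENNReal.ofReal (Real.exp
    (√((16 * τ) ^ 2 + ‖x.1‖ ^ 2) / (16 * τ) + 3 / (64 * τ ^ 2) * x.2)) with hΨ
  have hΨm : Measurable Ψ := by fun_prop
  have hσ : 0 ≤ σ := (integral_nonneg hr0).trans hrσ
  have main := lintegral_pi_sum_le P hΨm (hξ.prodMk hr) (lintegral_exp_bernstein_step_le P hτ hξ hr
    hξb hr0 hrb hξ0 hξσ hrσ) R 0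
  -- The potential is weighted so that either failure, of the norm at `3Rσ/τ` or of the sum at
  -- `4Rσ`, forces the same exponent `c`. Markov then leaves `1 + (7/100 - 3/16) Rσ/τ²`.
  set c : ℝ := 3 / 16 * (R * σ / τ ^ 2) with hc
  have hΨ0 : Ψ 0 = ENNReal.ofReal (Real.exp 1) := by
    simp only [hΨ, Prod.fst_zero, Prod.snd_zero, norm_zero]
    rw [show (16 * τ) ^ 2 + (0 : ℝ) ^ 2 = (16 * τ) ^ 2 by ring, Real.sqrt_sq (by positivity),
      div_self (by positivity), mul_zero, add_zero]
  have sub : {ω : Fin R → Ω | ¬ (‖∑ j, ξ (ω j)‖ ≤ 3 * R * σ / τ ∧ ∑ j, r (ω j) ≤ 4 * R * σ)} ⊆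
      {ω | ENNReal.ofReal (Real.exp c) ≤ Ψ (0 + ∑ j, (ξ (ω j), r (ω j)))} := by
    intro ω hω
    simp only [Set.mem_ofPred_eq, zero_add, hΨ, Prod.fst_sum, Prod.snd_sum] at hω ⊢
    refine ENNReal.ofReal_le_ofReal (Real.exp_le_exp.mpr ?_)
    have h1 : ‖∑ j, ξ (ω j)‖ ≤ √((16 * τ) ^ 2 + ‖∑ j, ξ (ω j)‖ ^ 2) :=
      Real.le_sqrt_of_sq_le (by nlinarith [sq_nonneg (16 * τ)])
    have h2 : 0 ≤ ∑ j, r (ω j) := Finset.sum_nonneg fun j _ => hr0 _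
    rw [not_and_or, not_le, not_le] at hω
    rcases hω with hω | hω
    · refine le_add_of_le_of_nonneg ?_ (by positivity)
      rw [le_div_iff₀ (by positivity)]
      refine le_trans (le_of_eq ?_) (hω.le.trans h1)
      rw [hc]; field_simp
    · refine le_add_of_nonneg_of_le (by positivity) ?_
      refine le_trans (le_of_eq ?_) (mul_le_mul_of_nonneg_left hω.le (by positivity))
      rw [hc]; field_simp; ring
  have hpos : ENNReal.ofReal (Real.exp c) ≠ 0 := by simpa using Real.exp_pos c
  have meas : Measurable fun ω : Fin R → Ω => Ψ (0 + ∑ j, (ξ (ω j), r (ω j))) := by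
    refine hΨm.comp (Measurable.const_add (Finset.measurable_sum _ fun j _ => ?_) _)
    exact (hξ.prodMk hr).comp (measurable_pi_apply j)
  refine (measure_mono sub).trans ((meas_ge_le_lintegral_div meas.aemeasurable hpos
    ENNReal.ofReal_ne_top).trans ((ENNReal.div_le_div_right main _).trans ?_))
  rw [hΨ0, ← ENNReal.ofReal_pow (Real.exp_pos _).le, ← Real.exp_nat_mul,
    ← ENNReal.ofReal_mul (Real.exp_pos _).le, ← Real.exp_add,
    ← ENNReal.ofReal_div_of_pos (Real.exp_pos _), ← Real.exp_sub]
  refine ENNReal.ofReal_le_ofReal (Real.exp_le_exp.mpr ?_)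
  have hQ : 0 ≤ R * σ / τ ^ 2 := by positivity
  have : R * (7 / 100 * σ / τ ^ 2) = 7 / 100 * (R * σ / τ ^ 2) := by ring
  rw [this, hc]
  linarith

end Bernstein

/-! ### Approximation by truncated random features -/

section RandomFeatures

variable {Ω : Type*} [MeasurableSpace Ω]

lemma integral_sq_sub_integral_le (P : Measure Ω) [IsProbabilityMeasure P] {f : Ω → ℝ}
    (hf : Integrable f P) (hf2 : Integrable (fun ω => f ω ^ 2) P) :
    ∫ ω, (f ω - ∫ ω', f ω' ∂P) ^ 2 ∂P ≤ ∫ ω, f ω ^ 2 ∂P := by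
  set c := ∫ ω', f ω' ∂P with hc
  have e : (fun ω => (f ω - c) ^ 2) = fun ω => f ω ^ 2 - 2 * c * f ω + c ^ 2 := by
    funext ω; ring
  have i1 : Integrable (fun ω => f ω ^ 2 - 2 * c * f ω) P := hf2.sub (hf.const_mul _)
  rw [e, integral_add i1 (integrable_const _), integral_sub hf2 (hf.const_mul _),
    integral_const_mul, ← hc]
  simp only [integral_const, probReal_univ, smul_eq_mul, one_mul]
  nlinarith [sq_nonneg c]

/-- Only values with `|G| > τ` are lost, and there `|G| ≤ G²/τ`. -/
lemma abs_integral_truncation_sub_le (P : Measure Ω) {G f : Ω → ℝ} {τ : ℝ} (hτ : 0 < τ)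
    (hG2 : Integrable (fun ω => G ω ^ 2) P) (hf1 : ∀ ω, |f ω| ≤ 1) :
    |∫ ω, ((if |G ω| ≤ τ then G ω else 0) * f ω - G ω * f ω) ∂P| ≤ (∫ ω, G ω ^ 2 ∂P) / τ := by
  rw [← integral_div, ← Real.norm_eq_abs]
  refine norm_integral_le_of_norm_le (hG2.div_const τ) (Filter.Eventually.of_forall fun ω => ?_)
  rw [Real.norm_eq_abs, ← sub_mul, abs_mul]
  refine (mul_le_of_le_one_right (abs_nonneg _) (hf1 ω)).trans ?_
  split_ifs with h
  · rw [sub_self, abs_zero]; positivity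
  · rw [zero_sub, abs_neg, le_div_iff₀ hτ, ← sq_abs (G ω), sq]
    exact mul_le_mul_of_nonneg_left (not_le.mp h).le (abs_nonneg _)

lemma sum_abs_div_card_le {n : ℕ} (a : Fin n → ℝ) :
    (1 / (n : ℝ)) * ∑ i, |a i| ≤ ‖WithLp.toLp 2 fun i => a i / √(n : ℝ)‖ := by
  rw [EuclideanSpace.norm_eq]
  refine Real.le_sqrt_of_sq_le ?_
  have h := sq_sum_le_card_mul_sum_sq (s := Finset.univ) (f := fun i => |a i|)
  simp only [Finset.card_univ, Fintype.card_fin, sq_abs] at h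
  simp only [Real.norm_eq_abs, sq_abs, div_pow, Real.sq_sqrt (Nat.cast_nonneg n),
    ← Finset.sum_div]
  rcases n.eq_zero_or_pos with rfl | hn
  · simp
  have hn' : (0 : ℝ) < n := Nat.cast_pos.mpr hn
  rw [mul_pow, div_pow, one_pow, le_div_iff₀ hn']
  calc _ ≤ 1 / (n : ℝ) ^ 2 * (n * ∑ i, a i ^ 2) * n := by gcongr
    _ = _ := by field_simp

lemma norm_sq_toLp_div_sqrt {n : ℕ} (a : Fin n → ℝ) :
    ‖WithLp.toLp 2 fun i => a i / √(n : ℝ)‖ ^ 2 = (1 / (n : ℝ)) * ∑ i, a i ^ 2 := by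
  rw [EuclideanSpace.norm_eq, Real.sq_sqrt (Finset.sum_nonneg fun i _ => sq_nonneg _)]
  simp only [Real.norm_eq_abs, sq_abs, div_pow, Real.sq_sqrt (Nat.cast_nonneg n),
    ← Finset.sum_div]
  ring

/-- Averages of `G` against finitely many bounded functions are approximated by random features
with small coefficients, with high probability. -/
theorem measure_not_exists_random_features_le (P : Measure Ω) [IsProbabilityMeasure P] {n R : ℕ}
    (hn : 0 < n) (hR : 0 < R) {f : Fin n → Ω → ℝ} (hfm : ∀ i, Measurable (f i))
    (hf1 : ∀ i ω, |f i ω| ≤ 1) {G : Ω → ℝ} (hGm : Measurable G)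
    (hG2 : Integrable (fun ω => G ω ^ 2) P) (hG1 : ∀ i, Integrable (fun ω => G ω * f i ω) P)
    {σ τ : ℝ} (hGσ : ∫ ω, G ω ^ 2 ∂P ≤ σ) (hτ : 0 < τ) :
    (Measure.pi fun _ : Fin R => P) {ω | ¬ ∃ v : Fin R → ℝ, ∑ j, v j ^ 2 ≤ 4 * R * σ ∧
        (1 / (n : ℝ)) * ∑ i, |(1 / (R : ℝ)) * ∑ j, v j * f i (ω j) - ∫ ω, G ω * f i ω ∂P| ≤
          4 * σ / τ} ≤
      ENNReal.ofReal (Real.exp (1 - R * σ / τ ^ 2 / 10)) := by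
  have hn' : (0 : ℝ) < n := Nat.cast_pos.mpr hn
  have hR' : (0 : ℝ) < R := Nat.cast_pos.mpr hR
  -- Only the second moment of `G` is quantitatively controlled. Truncation supplies the bound
  -- Bernstein needs, at the price of a bias `σ/τ`.
  set G' : Ω → ℝ := fun ω => if |G ω| ≤ τ then G ω else 0 with hG'
  have hG'm : Measurable G' :=
    Measurable.ite (measurableSet_le (by fun_prop) measurable_const) hGm measurable_const
  have hG'b : ∀ ω, |G' ω| ≤ τ := fun ω => by
    simp only [hG']; split_ifs with h
    · exact h
    · simpa using hτ.le
  have hG'sq : ∀ ω, G' ω ^ 2 ≤ G ω ^ 2 := fun ω => by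
    simp only [hG']; split_ifs with h
    · exact le_rfl
    · nlinarith [sq_nonneg (G ω)]
  set F : Fin n → Ω → ℝ := fun i ω => G' ω * f i ω with hF
  have hFm : ∀ i, Measurable (F i) := fun i => hG'm.mul (hfm i)
  have hFb : ∀ i ω, |F i ω| ≤ τ := fun i ω => by
    simp only [hF, abs_mul]
    exact (mul_le_of_le_one_right (abs_nonneg _) (hf1 i ω)).trans (hG'b ω)
  have hFi : ∀ i, Integrable (F i) P := fun i =>
    Integrable.of_bound (hFm i).aestronglyMeasurable τ (Filter.Eventually.of_forall (hFb i))
  have hF2i : ∀ i, Integrable (fun ω => F i ω ^ 2) P := fun i =>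
    Integrable.of_bound ((hFm i).pow_const 2).aestronglyMeasurable (τ ^ 2)
      (Filter.Eventually.of_forall fun ω => by
        rw [Real.norm_of_nonneg (sq_nonneg _), ← sq_abs]
        gcongr
        exact hFb i ω)
  set m : Fin n → ℝ := fun i => ∫ ω, F i ω ∂P with hm
  have hmb : ∀ i, |m i| ≤ τ := fun i => by
    have := norm_integral_le_of_norm_le_const (μ := P) (f := F i) (C := τ)
      (Filter.Eventually.of_forall (hFb i))
    simpa using this
  have hcb : ∀ i ω, |F i ω - m i| ≤ 2 * τ := fun i ω => by
    have := abs_sub (F i ω) (m i)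
    linarith [hFb i ω, hmb i]
  have hci : ∀ i, Integrable (fun ω => (F i ω - m i) ^ 2) P := fun i =>
    Integrable.of_bound (((hFm i).sub_const _).pow_const 2).aestronglyMeasurable ((2 * τ) ^ 2)
      (Filter.Eventually.of_forall fun ω => by
        rw [Real.norm_of_nonneg (sq_nonneg _), ← sq_abs]
        gcongr
        exact hcb i ω)
  -- Scaling by `1/√n` makes the Euclidean norm the empirical `L²` norm, which dominates the
  -- empirical `L¹` norm with no dependence on `n`.
  set ξ : Ω → EuclideanSpace ℝ (Fin n) := fun ω =>
    WithLp.toLp 2 fun i => (F i ω - m i) / √(n : ℝ) with hξ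
  have hξm : Measurable ξ := by
    refine (WithLp.measurable_toLp 2 (Fin n → ℝ)).comp (measurable_pi_lambda _ fun i => ?_)
    exact ((hFm i).sub_const _).div_const _
  have hξsq : ∀ ω, ‖ξ ω‖ ^ 2 = (1 / (n : ℝ)) * ∑ i, (F i ω - m i) ^ 2 := fun ω =>
    norm_sq_toLp_div_sqrt _
  have hξb : ∀ ω, ‖ξ ω‖ ≤ 2 * τ := fun ω => by
    refine le_of_sq_le_sq ?_ (by positivity)
    rw [hξsq]
    calc _ ≤ (1 / (n : ℝ)) * ∑ _i : Fin n, (2 * τ) ^ 2 := by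
          refine mul_le_mul_of_nonneg_left (Finset.sum_le_sum fun i _ => ?_) (by positivity)
          exact sq_le_sq' (abs_le.mp (hcb i ω)).1 (abs_le.mp (hcb i ω)).2
      _ = _ := by simp; field_simp
  have hξ0 : ∀ x : EuclideanSpace ℝ (Fin n), ∫ ω, inner ℝ x (ξ ω) ∂P = 0 := fun x => by
    simp only [hξ, PiLp.inner_apply]
    rw [integral_finsetSum]
    · refine Finset.sum_eq_zero fun i _ => ?_
      have e : (fun ω => inner ℝ (x i) ((F i ω - m i) / √(n : ℝ))) =
          fun ω => (x i / √(n : ℝ)) * (F i ω - m i) := by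
        funext ω; simp; ring
      rw [e, integral_const_mul, integral_sub (hFi i) (integrable_const _)]
      simp [hm]
    · intro i _
      have e : (fun ω => inner ℝ (x i) ((F i ω - m i) / √(n : ℝ))) =
          fun ω => (x i / √(n : ℝ)) * (F i ω - m i) := by
        funext ω; simp; ring
      rw [e]
      exact ((hFi i).sub (integrable_const _)).const_mul _
  have hG'2i : Integrable (fun ω => G' ω ^ 2) P :=
    hG2.mono' (hG'm.pow_const 2).aestronglyMeasurable (Filter.Eventually.of_forall fun ω => by
      rw [Real.norm_of_nonneg (sq_nonneg _)]; exact hG'sq ω)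
  have hrσ : ∫ ω, G' ω ^ 2 ∂P ≤ σ := (integral_mono hG'2i hG2 hG'sq).trans hGσ
  have hξσ : ∫ ω, ‖ξ ω‖ ^ 2 ∂P ≤ σ := by
    simp only [hξsq]
    rw [integral_const_mul, integral_finsetSum _ fun i _ => hci i]
    calc _ ≤ (1 / (n : ℝ)) * ∑ _i : Fin n, σ := by
          gcongr with i
          refine (integral_sq_sub_integral_le P (hFi i) (hF2i i)).trans
            ((integral_mono (hF2i i) hG'2i fun ω => ?_).trans hrσ)
          simp only [hF, mul_pow]
          refine mul_le_of_le_one_right (sq_nonneg _) ?_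
          rw [← sq_abs]
          exact pow_le_one₀ (abs_nonneg _) (hf1 i ω)
      _ = _ := by simp; field_simp
  refine (measure_mono fun ω hω => ?_).trans (measure_bernstein_le P hτ hξm (hG'm.pow_const 2) hξb
    (fun ω => sq_nonneg _) (fun ω => ?_) hξ0 hξσ hrσ R)
  · rw [Set.mem_ofPred_eq] at hω ⊢
    refine fun hgood => hω ⟨fun j => G' (ω j), hgood.2, ?_⟩
    have bias : ∀ i, |m i - ∫ ω, G ω * f i ω ∂P| ≤ σ / τ := fun i => by
      rw [hm, ← integral_sub (hFi i) (hG1 i)]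
      refine (abs_integral_truncation_sub_le P hτ hG2 (hf1 i)).trans ?_
      gcongr
    have dev : (1 / (n : ℝ)) * ∑ i, |(1 / (R : ℝ)) * ∑ j, F i (ω j) - m i| ≤ 3 * σ / τ := by
      refine (sum_abs_div_card_le _).trans ?_
      have e : (WithLp.toLp 2 fun i => ((1 / (R : ℝ)) * ∑ j, F i (ω j) - m i) / √(n : ℝ)) =
          (1 / (R : ℝ)) • ∑ j, ξ (ω j) := by
        ext i
        simp only [hξ, PiLp.smul_apply, WithLp.ofLp_sum, Finset.sum_apply, smul_eq_mul,
          ← Finset.sum_div, Finset.sum_sub_distrib]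
        simp
        field_simp
      rw [e, norm_smul, Real.norm_of_nonneg (by positivity), one_div_mul_eq_div,
        div_le_iff₀ hR']
      refine hgood.1.trans (le_of_eq ?_)
      ring
    calc _ ≤ (1 / (n : ℝ)) * ∑ i, (|(1 / (R : ℝ)) * ∑ j, F i (ω j) - m i| + σ / τ) := by
          gcongr with i
          refine (abs_sub_le _ (m i) _).trans ?_
          gcongr
          exact bias i
      _ = (1 / (n : ℝ)) * ∑ i, |(1 / (R : ℝ)) * ∑ j, F i (ω j) - m i| + σ / τ := by
          rw [Finset.sum_add_distrib, mul_add]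
          simp
          field_simp
      _ ≤ 3 * σ / τ + σ / τ := by gcongr
      _ = _ := by ring
  · rw [← sq_abs]
    gcongr
    exact hG'b ω

end RandomFeatures

/-! ### The kernel space and its functions on sample points -/

section KernelSpace

lemma kernel_comm {Z : Type*} [MetricSpace Z] [MeasurableSpace Z] (γ : ℝ≥0) (P : Measure Z)
    (x y : Z) : kernel γ P x y = kernel γ P y x := by
  simp only [kernel, mul_comm]

lemma abs_phi_le_one {Z : Type*} [MetricSpace Z] (γ : ℝ≥0) (ω x : Z) : |phi γ ω x| ≤ 1 := by
  rw [abs_of_nonneg (phi_nonneg γ ω x)]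
  exact phi_le_one γ ω x

lemma abs_phi_sub_phi_le {Z : Type*} [MetricSpace Z] (γ : ℝ≥0) (ω x y : Z) :
    |phi γ ω x - phi γ ω y| ≤ γ * dist x y := by
  have key : ∀ a b : ℝ, a ≤ 0 → b ≤ 0 → Real.exp a - Real.exp b ≤ |a - b| := by
    intro a b ha hb
    have h1 := Real.add_one_le_exp (b - a)
    have h2 : Real.exp b = Real.exp a * Real.exp (b - a) := by rw [← Real.exp_add]; ring_nf
    have h3 : Real.exp a ≤ 1 := Real.exp_le_one_iff.mpr ha
    have h4 := Real.exp_pos a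
    rcases le_total a b with h | h
    · have := Real.exp_le_exp.mpr h
      linarith [abs_nonneg (a - b)]
    · rw [abs_of_nonneg (sub_nonneg.mpr h), h2]
      nlinarith
  have h0 : ∀ x : Z, -(γ : ℝ) * dist x ω ≤ 0 := fun x => by
    have : 0 ≤ (γ : ℝ) * dist x ω := mul_nonneg γ.2 dist_nonneg
    linarith
  have hd : |(-(γ : ℝ) * dist x ω) - (-(γ : ℝ) * dist y ω)| ≤ γ * dist x y := by
    rw [show (-(γ : ℝ) * dist x ω) - (-(γ : ℝ) * dist y ω) = -(γ * (dist x ω - dist y ω)) by ring,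
      abs_neg, abs_mul, NNReal.abs_eq]
    exact mul_le_mul_of_nonneg_left (abs_dist_sub_le x y ω) γ.2
  have h1 := (key _ _ (h0 x) (h0 y)).trans hd
  have h2 := key _ _ (h0 y) (h0 x)
  rw [abs_sub_comm] at h2
  unfold phi
  exact abs_le.mpr ⟨by linarith, h1⟩

variable {Z : Type*} [MetricSpace Z] [MeasurableSpace Z] [BorelSpace Z] {γ : ℝ≥0}
  {P : Measure Z} [IsProbabilityMeasure P] {X : Set Z}

/-- The kernel function `k(x, ·)`. -/
noncomputable def kernelFunction (γ : ℝ≥0) (P : Measure Z) [IsProbabilityMeasure P] {X : Set Z} (x : X) :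
    KernelSpace γ P X :=
  RKHS.kerFun (KernelSpace γ P X) x (1 : ℝ)

lemma inner_kernelFunction (x : X) (f : KernelSpace γ P X) :
    inner ℝ (kernelFunction γ P x) f = f x := by
  rw [kernelFunction, RKHS.kerFun_inner]
  simp

lemma kernelFunction_apply (x y : X) :
    kernelFunction γ P x y = kernel γ P (y : Z) (x : Z) := by
  rw [kernelFunction, RKHS.kerFun_apply, RKHS.OfKernel.kernel_ofKernel]
  simp [kernelMatrix]

lemma measurable_phi (γ : ℝ≥0) (x : Z) : Measurable fun ω => phi γ ω x := by
  have hc : Continuous fun ω => phi γ ω x := by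
    unfold phi
    fun_prop
  exact hc.measurable

/-- Both sides expand into the same double sum of kernel values: combinations of kernel functions
embed isometrically into `L²(P)`. -/
lemma norm_sq_sum_kernelFunction {n : ℕ} (x : Fin n → X) (β : Fin n → ℝ) :
    ‖∑ i, β i • kernelFunction γ P (x i)‖ ^ 2 =
      ∫ ω, (∑ i, β i * phi γ ω (x i)) ^ 2 ∂P := by
  have hint : ∀ i j, Integrable
      (fun ω : Z => β i * phi γ ω (x i) * (β j * phi γ ω (x j))) P := fun i j => by
    refine ((integrable_phi_mul_phi γ P (x i : Z) (x j : Z)).const_mul (β i * β j)).congr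
      (Filter.Eventually.of_forall fun ω => ?_)
    simp only
    ring
  simp only [sq (∑ i, _), Finset.sum_mul_sum]
  rw [← real_inner_self_eq_norm_sq, sum_inner,
    integral_finsetSum _ fun i _ => integrable_finsetSum _ fun j _ => hint i j]
  refine Finset.sum_congr rfl fun i _ => ?_
  rw [inner_sum, integral_finsetSum _ fun j _ => hint i j]
  refine Finset.sum_congr rfl fun j _ => ?_
  rw [real_inner_smul_left, real_inner_smul_right, inner_kernelFunction, kernelFunction_apply,
    kernel, ← integral_const_mul, ← integral_const_mul]
  refine integral_congr_ae (Filter.Eventually.of_forall fun ω => ?_)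
  simp only
  ring

/-- On finitely many points, a function in `ℋ` is an average of the features with weights of no
larger norm. -/
lemma exists_weights_eq_on_points {n : ℕ} (x : Fin n → X) (h : KernelSpace γ P X) :
    ∃ β : Fin n → ℝ, ∫ ω, (∑ i, β i * phi γ ω (x i)) ^ 2 ∂P ≤ ‖h‖ ^ 2 ∧
      ∀ k, ∫ ω, (∑ i, β i * phi γ ω (x i)) * phi γ ω (x k) ∂P = h (x k) := by
  -- Projecting onto the span of the kernel functions at the points keeps the values there, by
  -- reproduction, and does not increase the norm.
  set U : Submodule ℝ (KernelSpace γ P X) :=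
    Submodule.span ℝ (Set.range fun i => kernelFunction γ P (x i)) with hU
  have : FiniteDimensional ℝ U := FiniteDimensional.span_of_finite ℝ (Set.finite_range _)
  obtain ⟨β, hβ⟩ := (Submodule.mem_span_range_iff_exists_fun ℝ).mp
    (U.starProjection_apply_mem h)
  refine ⟨β, ?_, fun k => ?_⟩
  · rw [← norm_sq_sum_kernelFunction, hβ]
    gcongr
    exact U.norm_starProjection_apply_le h
  · have h1 : inner ℝ (kernelFunction γ P (x k)) (U.starProjection h) = h (x k) := by
      rw [← inner_kernelFunction (x k) h]
      have := U.sub_starProjection_mem_orthogonal h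
      have h2 := (Submodule.mem_orthogonal U _).mp this (kernelFunction γ P (x k))
        (Submodule.subset_span ⟨k, rfl⟩)
      rw [inner_sub_right] at h2
      linarith
    rw [← h1, ← hβ, inner_sum]
    simp only [Finset.sum_mul]
    rw [integral_finsetSum]
    · refine Finset.sum_congr rfl fun i _ => ?_
      rw [real_inner_smul_right, inner_kernelFunction, kernelFunction_apply, kernel,
        ← integral_const_mul]
      refine integral_congr_ae (Filter.Eventually.of_forall fun ω => ?_)
      simp only
      ring
    · intro i _
      refine ((integrable_phi_mul_phi γ P (x i : Z) (x k : Z)).const_mul (β i)).congr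
        (Filter.Eventually.of_forall fun ω => ?_)
      simp only
      ring

lemma norm_kernelFunction_le_one (x : X) : ‖kernelFunction γ P x‖ ≤ 1 := by
  refine le_of_sq_le_sq ?_ zero_le_one
  rw [← real_inner_self_eq_norm_sq, inner_kernelFunction, kernelFunction_apply, kernel]
  refine (integral_mono (integrable_phi_mul_phi γ P _ _) (integrable_const 1) fun ω =>
    mul_le_one₀ (phi_le_one γ ω x) (phi_nonneg γ ω x) (phi_le_one γ ω x)).trans ?_
  simp

lemma abs_apply_le_norm (f : KernelSpace γ P X) (x : X) : |f x| ≤ ‖f‖ := by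
  rw [← inner_kernelFunction x f]
  refine (abs_real_inner_le_norm _ _).trans ?_
  exact mul_le_of_le_one_left (norm_nonneg _) (norm_kernelFunction_le_one x)

lemma continuous_coe_kernelSpace (f : KernelSpace γ P X) : Continuous f := by
  have hk : ∀ x y : X, ‖kernelFunction γ P x - kernelFunction γ P y‖ ≤ γ * dist x y := by
    intro x y
    refine le_of_sq_le_sq ?_ (mul_nonneg γ.2 dist_nonneg)
    have e := norm_sq_sum_kernelFunction (γ := γ) (P := P) ![x, y] ![1, -1]
    simp only [Fin.sum_univ_two, Matrix.cons_val_zero, Matrix.cons_val_one, one_smul, one_mul,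
      neg_smul, neg_mul, ← sub_eq_add_neg] at e
    rw [e]
    refine (integral_mono_of_nonneg (Filter.Eventually.of_forall fun ω => sq_nonneg _)
      (integrable_const ((γ * dist x y) ^ 2)) (Filter.Eventually.of_forall fun ω => ?_)).trans ?_
    · simp only
      rw [← sq_abs]
      gcongr
      exact abs_phi_sub_phi_le γ ω x y
    · simp
  refine (LipschitzWith.of_dist_le_mul (K := ‖f‖₊ * γ) fun x y => ?_).continuous
  rw [Real.dist_eq, ← inner_kernelFunction x f, ← inner_kernelFunction y f, ← inner_sub_left,
    mul_comm ‖f‖₊]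
  refine (abs_real_inner_le_norm _ _).trans ?_
  push_cast
  rw [mul_right_comm]
  exact mul_le_mul_of_nonneg_right (hk x y) (norm_nonneg _)

/-- Triangle inequality with kernel functions of norm at most one; this is how `A` enters as a
radius. -/
lemma norm_le_of_coefficients {n : ℕ} {f : KernelSpace γ P X} (x : Fin n → X) {α : Fin n → ℝ}
    {A : ℝ} (hf : ∀ y : X, f y = (1 / (n : ℝ)) * ∑ i, α i * kernel γ P (x i : Z) (y : Z))
    (hα : (1 / (n : ℝ)) * ∑ i, |α i| ≤ A) : ‖f‖ ≤ A := by
  have e : f = (1 / (n : ℝ)) • ∑ i, α i • kernelFunction γ P (x i) := by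
    refine RKHS.ext fun y => ?_
    rw [hf, ← inner_kernelFunction y ((1 / (n : ℝ)) • ∑ i, α i • kernelFunction γ P (x i)),
      real_inner_smul_right, inner_sum]
    congr 1
    refine Finset.sum_congr rfl fun i _ => ?_
    rw [real_inner_smul_right, inner_kernelFunction, kernelFunction_apply, kernel_comm]
  rw [e, norm_smul, Real.norm_of_nonneg (by positivity)]
  refine le_trans ?_ hα
  gcongr
  refine (norm_sum_le _ _).trans (Finset.sum_le_sum fun i _ => ?_)
  rw [norm_smul]
  exact mul_le_of_le_one_right (norm_nonneg _) (norm_kernelFunction_le_one _)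

end KernelSpace

/-! ### Lipschitz estimates for risks -/

section Risk

variable {I Y : Type*} {loss : ℝ → Y → ℝ} {M : ℝ}

lemma abs_empiricalRisk_sub_le (hLip : ∀ a b y, |loss a y - loss b y| ≤ M * |a - b|) {n : ℕ}
    (S : Fin n → I × Y) (f g : I → ℝ) :
    |empiricalRisk loss S f - empiricalRisk loss S g| ≤
      M * ((1 / (n : ℝ)) * ∑ i, |f (S i).1 - g (S i).1|) := by
  unfold empiricalRisk
  rw [← mul_sub, ← Finset.sum_sub_distrib, abs_mul, abs_of_nonneg (by positivity : 0 ≤ 1 / (n : ℝ)),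
    mul_left_comm, Finset.mul_sum]
  refine mul_le_mul_of_nonneg_left ((Finset.abs_sum_le_sum_abs _ _).trans ?_) (by positivity)
  exact Finset.sum_le_sum fun i _ => hLip _ _ _

lemma abs_empiricalRisk_sub_le_of_le (hM : 0 ≤ M)
    (hLip : ∀ a b y, |loss a y - loss b y| ≤ M * |a - b|) {n : ℕ}
    (S : Fin n → I × Y) {f g : I → ℝ} {K : ℝ} (hK : 0 ≤ K) (h : ∀ x, |f x - g x| ≤ K) :
    |empiricalRisk loss S f - empiricalRisk loss S g| ≤ M * K := by
  refine (abs_empiricalRisk_sub_le hLip S f g).trans (mul_le_mul_of_nonneg_left ?_ hM)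
  calc _ ≤ (1 / (n : ℝ)) * ∑ _i : Fin n, K :=
        mul_le_mul_of_nonneg_left (Finset.sum_le_sum fun i _ => h _) (by positivity)
    _ ≤ K := by
        rcases n.eq_zero_or_pos with rfl | hn
        · simpa using hK
        · have : (0 : ℝ) < n := Nat.cast_pos.mpr hn
          simp; field_simp; exact le_rfl

lemma continuous_of_abs_sub_le {E : Type*} [SeminormedAddCommGroup E] {F : E → ℝ} (hM : 0 ≤ M)
    (h : ∀ w v, |F w - F v| ≤ M * ‖w - v‖) : Continuous F :=
  (LipschitzWith.of_dist_le_mul (K := ⟨M, hM⟩) fun w v => by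
    rw [Real.dist_eq, dist_eq_norm]; exact h w v).continuous

variable [MeasurableSpace I] [MeasurableSpace Y] {ρ : Measure (I × Y)} [IsProbabilityMeasure ρ]

lemma integrable_loss (hM : 0 ≤ M) (hm : Measurable fun q : ℝ × Y => loss q.1 q.2)
    (hLip : ∀ a b y, |loss a y - loss b y| ≤ M * |a - b|)
    (h0 : Integrable (fun z : I × Y => loss 0 z.2) ρ) {f : I → ℝ} (hf : Measurable f) {K : ℝ}
    (hK : ∀ x, |f x| ≤ K) : Integrable (fun z : I × Y => loss (f z.1) z.2) ρ := by
  refine (h0.norm.add (integrable_const (M * K))).mono'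
    (hm.comp ((hf.comp measurable_fst).prodMk measurable_snd)).aestronglyMeasurable
    (Filter.Eventually.of_forall fun z => ?_)
  have h1 := hLip (f z.1) 0 z.2
  rw [sub_zero] at h1
  have h2 := abs_sub_abs_le_abs_sub (loss (f z.1) z.2) (loss 0 z.2)
  have h3 := mul_le_mul_of_nonneg_left (hK z.1) hM
  simp only [Pi.add_apply, Real.norm_eq_abs]
  linarith

lemma abs_risk_sub_le (hM : 0 ≤ M) (hLip : ∀ a b y, |loss a y - loss b y| ≤ M * |a - b|)
    {f g : I → ℝ} (hf : Integrable (fun z : I × Y => loss (f z.1) z.2) ρ)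
    (hg : Integrable (fun z : I × Y => loss (g z.1) z.2) ρ) {K : ℝ}
    (h : ∀ x, |f x - g x| ≤ K) : |risk loss ρ f - risk loss ρ g| ≤ M * K := by
  unfold risk
  rw [← integral_sub hf hg]
  have := norm_integral_le_of_norm_le_const (μ := ρ)
    (f := fun z => loss (f z.1) z.2 - loss (g z.1) z.2) (C := M * K)
    (Filter.Eventually.of_forall fun z =>
      (hLip _ _ _).trans (mul_le_mul_of_nonneg_left (h z.1) hM))
  simpa using this

/-- Deviation of the excess empirical risk of a single bounded function. -/
lemma measure_empiricalRisk_deviation_le (hM : 0 < M)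
    (hm : Measurable fun q : ℝ × Y => loss q.1 q.2)
    (hLip : ∀ a b y, |loss a y - loss b y| ≤ M * |a - b|) {f : I → ℝ} (hf : Measurable f)
    {C : ℝ} (hC : 0 < C) (hfC : ∀ x, |f x| ≤ C) {b t : ℝ} (hb : 0 < b) {n : ℕ} (hn : 0 < n) :
    (Measure.pi fun _ : Fin n => ρ) {S | b * C ^ 2 + t ≤
        (1 / (n : ℝ)) * ∑ k, (loss (f (S k).1) (S k).2 - loss 0 (S k).2) -
        ∫ z, (loss (f z.1) z.2 - loss 0 z.2) ∂ρ} ≤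
      ENNReal.ofReal (Real.exp (1 / 2 - b * n * t / (4 * M ^ 2))) := by
  have h := measure_exists_deviation_le (ι := Unit) ρ (fun _ => C) (b := b) (M := M) (t := t)
    (g := fun _ z => -(loss (f z.1) z.2 - loss 0 z.2)) (φ := fun _ => (1 : ℝ)) hM hb
    (fun _ => (Measurable.sub (hm.comp ((hf.comp measurable_fst).prodMk measurable_snd))
      (hm.comp (measurable_const.prodMk measurable_snd))).neg)
    (fun v => measurable_const) (fun _ => by simp)
    (fun _ z => by
      rw [abs_neg]
      refine (hLip _ _ _).trans (mul_le_mul_of_nonneg_left ?_ hM.le)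
      simpa [abs_of_pos hC] using hfC z.1)
    (fun _ _ z => by simp) hn
  refine (measure_mono fun S hS => ?_).trans h
  refine ⟨(), ?_⟩
  rw [Set.mem_ofPred_eq] at hS
  rw [integral_neg, Finset.sum_neg_distrib, Real.norm_of_nonneg hC.le]
  linarith

end Risk

/-! ### Separability, measurability and existence of minimizers -/

section Setting

/-- Finite covering numbers at all small scales give countable almost dense sets. Separability of
`X` is what makes the features jointly measurable in input and random object. -/
lemma secondCountableTopology_of_coverExponents_nonempty {Z : Type*} [MetricSpace Z] {X : Set Z}
    (h : (coverExponents X).Nonempty) : SecondCountableTopology X := by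
  obtain ⟨p, -, c, -, hc⟩ := h
  refine Metric.secondCountable_of_almost_dense_set fun ε hε => ?_
  set δ : ℝ := min ε (1 / 2) with hδ
  have hδ0 : 0 < δ := lt_min hε (by norm_num)
  have hδ1 : δ < 1 := (min_le_right _ _).trans_lt (by norm_num)
  have hfin : Metric.coveringNumber δ.toNNReal X ≠ ⊤ := by
    intro htop
    have := hc δ hδ0 hδ1
    rw [htop] at this
    exact absurd this (by simp)
  refine ⟨Subtype.val ⁻¹' Metric.minimalCover δ.toNNReal X,
    (Metric.finite_minimalCover.preimage Subtype.val_injective.injOn).countable, fun x => ?_⟩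
  obtain ⟨y, hy, hxy⟩ := Metric.isCover_minimalCover hfin x.2
  refine ⟨⟨y, Metric.minimalCover_subset hy⟩, hy, ?_⟩
  have h1 : edist (x : Z) y ≤ δ.toNNReal := hxy
  rw [edist_dist, ← ENNReal.ofReal_coe_nnreal, Real.coe_toNNReal _ hδ0.le,
    ENNReal.ofReal_le_ofReal_iff hδ0.le] at h1
  exact h1.trans (min_le_left _ _)

lemma effectiveDimension_nonneg {Z : Type*} [MetricSpace Z] (X : Set Z) :
    0 ≤ effectiveDimension X :=
  Real.sInf_nonneg fun _ hp => hp.1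

variable {Z Y : Type*} [MetricSpace Z] {X : Set Z} {R : ℕ}

lemma linearFunction_eq_inner (γ : ℝ≥0) (ω : Fin R → Z) (w : EuclideanSpace ℝ (Fin R)) (x : X) :
    linearFunction γ ω w x = inner ℝ w (features γ ω (x : Z)) := by
  simp only [linearFunction, PiLp.inner_apply]
  refine Finset.sum_congr rfl fun j _ => ?_
  simp [mul_comm]

lemma norm_features_le_one (γ : ℝ≥0) (ω : Fin R → Z) (x : Z) : ‖features γ ω x‖ ≤ 1 := by
  refine le_of_sq_le_sq ?_ zero_le_one
  have h := norm_sq_toLp_div_sqrt fun j : Fin R => phi γ (ω j) x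
  have e : features γ ω x = WithLp.toLp 2 fun j => phi γ (ω j) x / √(R : ℝ) := by
    unfold features
    congr 1
    funext j
    ring
  rw [e, h]
  calc _ ≤ (1 / (R : ℝ)) * ∑ _j : Fin R, (1 : ℝ) := by
        refine mul_le_mul_of_nonneg_left (Finset.sum_le_sum fun j _ => ?_) (by positivity)
        exact pow_le_one₀ (phi_nonneg _ _ _) (phi_le_one _ _ _)
    _ ≤ 1 ^ 2 := by
        rcases R.eq_zero_or_pos with rfl | hR
        · simp
        · have : (0 : ℝ) < R := Nat.cast_pos.mpr hR
          simp; field_simp; exact le_rfl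

lemma abs_linearFunction_le (γ : ℝ≥0) (ω : Fin R → Z) (w : EuclideanSpace ℝ (Fin R)) (x : X) :
    |linearFunction γ ω w x| ≤ ‖w‖ := by
  rw [linearFunction_eq_inner]
  exact (abs_real_inner_le_norm _ _).trans
    (mul_le_of_le_one_right (norm_nonneg _) (norm_features_le_one _ _ _))

lemma abs_linearFunction_sub_le (γ : ℝ≥0) (ω : Fin R → Z) (w v : EuclideanSpace ℝ (Fin R))
    (x : X) : |linearFunction γ ω w x - linearFunction γ ω v x| ≤ ‖w - v‖ := by
  rw [linearFunction_eq_inner, linearFunction_eq_inner, ← inner_sub_left,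
    ← linearFunction_eq_inner]
  exact abs_linearFunction_le _ _ _ _

variable {loss : ℝ → Y → ℝ} {M : ℝ}

lemma continuous_empiricalRisk_linearFunction (hM : 0 ≤ M)
    (hLip : ∀ a b y, |loss a y - loss b y| ≤ M * |a - b|) (γ : ℝ≥0) {n : ℕ} (S : Fin n → X × Y)
    (ω : Fin R → Z) : Continuous fun w => empiricalRisk loss S (linearFunction γ ω w) :=
  continuous_of_abs_sub_le hM fun w v =>
    abs_empiricalRisk_sub_le_of_le hM hLip S (norm_nonneg _)
      (abs_linearFunction_sub_le γ ω w v)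

lemma continuous_objective (hM : 0 ≤ M)
    (hLip : ∀ a b y, |loss a y - loss b y| ≤ M * |a - b|) (γ : ℝ≥0) (μ : ℝ) {n : ℕ}
    (S : Fin n → X × Y) (ω : Fin R → Z) : Continuous (objective γ loss μ S ω) := by
  unfold objective
  exact (continuous_empiricalRisk_linearFunction hM hLip γ S ω).add (by fun_prop)

/-- The regularized empirical risk has a minimizer. -/
lemma exists_isRandomFeatureEstimator (hM : 0 ≤ M)
    (hLip : ∀ a b y, |loss a y - loss b y| ≤ M * |a - b|) (γ : ℝ≥0) {μ : ℝ} (hμ : 0 < μ) {n : ℕ}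
    (S : Fin n → X × Y) (ω : Fin R → Z) : ∃ f, IsRandomFeatureEstimator γ loss μ S ω f := by
  have hlim : Filter.Tendsto (objective γ loss μ S ω)
      (Filter.cocompact (EuclideanSpace ℝ (Fin R))) Filter.atTop := by
    have hq : Filter.Tendsto (fun r : ℝ => r * (μ / 2 * r - M) +
        empiricalRisk loss S (linearFunction γ ω 0)) Filter.atTop Filter.atTop := by
      refine Filter.tendsto_atTop_add_const_right _ _ (Filter.tendsto_id.atTop_mul_atTop₀ ?_)
      exact Filter.tendsto_atTop_add_const_right _ _
        (Filter.tendsto_id.const_mul_atTop (by positivity))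
    refine Filter.tendsto_atTop_mono (fun w => ?_)
      (hq.comp (tendsto_norm_cocompact_atTop (E := EuclideanSpace ℝ (Fin R))))
    have h1 := abs_empiricalRisk_sub_le_of_le hM hLip S (norm_nonneg _)
      (abs_linearFunction_sub_le γ ω w 0)
    rw [sub_zero] at h1
    have h2 := (abs_le.mp h1).1
    simp only [Function.comp_apply, objective]
    linarith
  obtain ⟨w, hw⟩ := (continuous_objective hM hLip γ μ S ω).exists_forall_le hlim
  exact ⟨_, w, hw, rfl⟩

variable [MeasurableSpace Z] [BorelSpace Z]

/-- A Carathéodory function: continuous in the input, which ranges over a separable space, and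
measurable in `ω`. `Z` itself need not be separable. -/
lemma measurable_phi_prod (γ : ℝ≥0) [SecondCountableTopology X] :
    Measurable fun p : X × Z => phi γ p.2 (p.1 : Z) := by
  refine measurable_uncurry_of_continuous_of_measurable (u := fun (x : X) (ω : Z) => phi γ ω (x : Z))
    (fun ω => ?_) fun x => measurable_phi γ (x : Z)
  unfold phi
  fun_prop

lemma measurable_linearFunction_comp (γ : ℝ≥0) [SecondCountableTopology X]
    (w : EuclideanSpace ℝ (Fin R)) {α : Type*} [MeasurableSpace α] {a : α → Fin R → Z}
    {x : α → X} (ha : Measurable a) (hx : Measurable x) :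
    Measurable fun q => linearFunction γ (a q) w (x q) := by
  unfold linearFunction features
  refine Finset.measurable_sum _ fun j _ => ?_
  have h : Measurable fun q => phi γ (a q j) (x q : Z) :=
    (measurable_phi_prod γ).comp (hx.prodMk ((measurable_pi_apply j).comp ha))
  exact (h.const_mul _).const_mul _

lemma measurable_inner_features (γ : ℝ≥0) (ω : Fin R → Z)
    (w : EuclideanSpace ℝ (Fin R)) :
    Measurable fun x : X => inner ℝ w (features γ ω (x : Z)) := by
  simp only [← linearFunction_eq_inner]
  unfold linearFunction features
  refine Finset.measurable_sum _ fun j _ => ?_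
  have hc : Continuous fun x : X => phi γ (ω j) (x : Z) := by
    unfold phi
    fun_prop
  exact (hc.measurable.const_mul _).const_mul _

end Setting

/-! ### Exceptional events with the random objects or the sample fixed -/

section Events

variable {Z Y : Type*} [MetricSpace Z] [MeasurableSpace Z] [BorelSpace Z]
  {X : Set Z} {R n : ℕ} {loss : ℝ → Y → ℝ} {M : ℝ}

/-- Uniform one-sided deviation of the excess empirical risk of linear functions of the features,
for fixed random objects. -/
lemma measure_exists_linearFunction_deviation_le [MeasurableSpace Y] {ρ : Measure (X × Y)}
    [IsProbabilityMeasure ρ] (hM : 0 < M)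
    (hm : Measurable fun q : ℝ × Y => loss q.1 q.2)
    (hLip : ∀ a b y, |loss a y - loss b y| ≤ M * |a - b|)
    (γ : ℝ≥0) (ω : Fin R → Z) {ι : Type*} [Countable ι]
    (W : ι → EuclideanSpace ℝ (Fin R)) {b t : ℝ} (hb : 0 < b) (hn : 0 < n) :
    (Measure.pi fun _ : Fin n => ρ) {S | ∃ i, b * ‖W i‖ ^ 2 + t ≤
        ∫ z, (loss (linearFunction γ ω (W i) z.1) z.2 - loss 0 z.2) ∂ρ -
          (1 / (n : ℝ)) * ∑ k, (loss (linearFunction γ ω (W i) (S k).1) (S k).2 -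
            loss 0 (S k).2)} ≤
      ENNReal.ofReal (Real.exp (1 / 2 - b * n * t / (4 * M ^ 2))) := by
  refine measure_exists_deviation_le ρ W
    (g := fun i z => loss (linearFunction γ ω (W i) z.1) z.2 - loss 0 z.2)
    (φ := fun z => features γ ω (z.1 : Z)) hM hb (fun i => ?_)
    (fun v => (measurable_inner_features γ ω v).comp measurable_fst)
    (fun z => norm_features_le_one _ _ _) (fun i z => ?_) (fun i j z => ?_) hn
  · refine Measurable.sub (hm.comp (Measurable.prodMk ?_ measurable_snd))
      (hm.comp (measurable_const.prodMk measurable_snd))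
    have h := measurable_inner_features (X := X) γ ω (W i)
    simp only [← linearFunction_eq_inner] at h
    exact h.comp measurable_fst
  · rw [← linearFunction_eq_inner]
    simpa using hLip (linearFunction γ ω (W i) z.1) 0 z.2
  · rw [← linearFunction_eq_inner, ← linearFunction_eq_inner, sub_sub_sub_cancel_right]
    exact hLip _ _ _

/-- For a fixed sample, the regularized empirical risk of some weights of the random features
nearly attains the empirical risk of a given function in a ball of `ℋ`. -/
lemma measure_objective_ge_le {γ : ℝ≥0} {P : Measure Z} [IsProbabilityMeasure P] (hM : 0 < M)
    (hLip : ∀ a b y, |loss a y - loss b y| ≤ M * |a - b|) (hn : 0 < n) (hR : 0 < R)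
    (S : Fin n → X × Y) (h : KernelSpace γ P X) {B ε μ : ℝ} (hB : 0 < B) (hε : 0 < ε)
    (hμ : 0 ≤ μ) (hh : ‖h‖ ≤ B) :
    (Measure.pi fun _ : Fin R => P) {ω | ¬ ∃ w, objective γ loss μ S ω w ≤
        empiricalRisk loss S h + ε / 8 + 2 * μ * B ^ 2} ≤
      ENNReal.ofReal (Real.exp (1 - R * ε ^ 2 / (10240 * M ^ 2 * B ^ 2))) := by
  have hR' : (0 : ℝ) < R := Nat.cast_pos.mpr hR
  obtain ⟨β, hβ1, hβ2⟩ := exists_weights_eq_on_points (fun i => (S i).1) h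
  set G : Z → ℝ := fun ω => ∑ i, β i * phi γ ω (S i).1 with hG
  have hGm : Measurable G :=
    Finset.measurable_sum _ fun i _ => (measurable_phi γ _).const_mul _
  have hGb : ∀ ω, |G ω| ≤ ∑ i, |β i| := fun ω => by
    refine (Finset.abs_sum_le_sum_abs _ _).trans (Finset.sum_le_sum fun i _ => ?_)
    rw [abs_mul]
    exact mul_le_of_le_one_right (abs_nonneg _) (abs_phi_le_one _ _ _)
  have hG2 : Integrable (fun ω => G ω ^ 2) P := by
    refine Integrable.of_bound (hGm.pow_const 2).aestronglyMeasurable ((∑ i, |β i|) ^ 2)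
      (Filter.Eventually.of_forall fun ω => ?_)
    rw [Real.norm_of_nonneg (sq_nonneg _), ← sq_abs]
    exact pow_le_pow_left₀ (abs_nonneg _) (hGb ω) 2
  have hG1 : ∀ i, Integrable (fun ω => G ω * phi γ ω (S i).1) P := fun i => by
    refine Integrable.of_bound (hGm.mul (measurable_phi γ _)).aestronglyMeasurable (∑ i, |β i|)
      (Filter.Eventually.of_forall fun ω => ?_)
    rw [Real.norm_eq_abs, abs_mul]
    exact (mul_le_of_le_one_right (abs_nonneg _) (abs_phi_le_one _ _ _)).trans (hGb ω)
  -- The truncation level `τ` is chosen so that the loss error `M · 4B²/τ` equals `ε/8`.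
  have main := measure_not_exists_random_features_le P (R := R) hn hR
    (f := fun i ω => phi γ ω (S i).1) (fun i => measurable_phi γ _)
    (fun i ω => abs_phi_le_one _ _ _) hGm hG2 hG1 (σ := B ^ 2) (τ := 32 * M * B ^ 2 / ε)
    (hβ1.trans (by gcongr)) (by positivity)
  have e1 : R * B ^ 2 / (32 * M * B ^ 2 / ε) ^ 2 / 10 = R * ε ^ 2 / (10240 * M ^ 2 * B ^ 2) := by
    field_simp
    norm_num
  rw [e1] at main
  refine (measure_mono fun ω hω => ?_).trans main
  rw [Set.mem_ofPred_eq] at hω ⊢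
  refine fun hbad => hω ?_
  obtain ⟨v, hv1, hv2⟩ := hbad
  refine ⟨WithLp.toLp 2 fun j => v j / √(R : ℝ), ?_⟩
  have hw : ‖(WithLp.toLp 2 fun j => v j / √(R : ℝ) : EuclideanSpace ℝ (Fin R))‖ ^ 2 ≤
      4 * B ^ 2 := by
    rw [norm_sq_toLp_div_sqrt, one_div_mul_eq_div, div_le_iff₀ hR']
    linarith
  have hlin : ∀ x : X, linearFunction γ ω (WithLp.toLp 2 fun j => v j / √(R : ℝ)) x =
      (1 / (R : ℝ)) * ∑ j, v j * phi γ (ω j) (x : Z) := fun x => by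
    unfold linearFunction features
    rw [Finset.mul_sum]
    refine Finset.sum_congr rfl fun j _ => ?_
    have := Real.mul_self_sqrt hR'.le
    have hs : √(R : ℝ) ≠ 0 := (Real.sqrt_pos.mpr hR').ne'
    simp only
    rw [show v j / √(R : ℝ) * (1 / √(R : ℝ) * phi γ (ω j) (x : Z)) =
      v j * phi γ (ω j) (x : Z) / (√(R : ℝ) * √(R : ℝ)) by field_simp, this]
    ring
  have h1 := (abs_le.mp (abs_empiricalRisk_sub_le hLip S
    (linearFunction γ ω (WithLp.toLp 2 fun j => v j / √(R : ℝ))) h)).2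
  have h2 : (1 / (n : ℝ)) * ∑ i, |linearFunction γ ω (WithLp.toLp 2 fun j => v j / √(R : ℝ))
      (S i).1 - h (S i).1| ≤ 4 * B ^ 2 / (32 * M * B ^ 2 / ε) := by
    refine le_of_eq_of_le ?_ hv2
    simp only [hlin, hG, hβ2]
  have h3 := mul_le_mul_of_nonneg_left h2 hM.le
  have e2 : M * (4 * B ^ 2 / (32 * M * B ^ 2 / ε)) = ε / 8 := by
    field_simp
    norm_num
  rw [e2] at h3
  have h4 := mul_le_mul_of_nonneg_left hw (by positivity : 0 ≤ μ / 2)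
  unfold objective
  linarith

end Events

/-! ### Exceptional events on the product space and the risk comparison -/

section Main

lemma half_le_log_two_div {δ : ℝ} (h0 : 0 < δ) (h1 : δ < 1) : 1 / 2 ≤ Real.log (2 / δ) := by
  have h2 := Real.log_two_gt_d9
  have h3 : Real.log 2 ≤ Real.log (2 / δ) :=
    Real.log_le_log two_pos (by rw [le_div_iff₀ h0]; linarith)
  linarith

lemma ofReal_exp_le_of_le {δ y : ℝ} (h0 : 0 < δ) (h1 : δ < 1) (hy : y ≤ -3 * Real.log (2 / δ)) :
    ENNReal.ofReal (Real.exp y) ≤ ENNReal.ofReal (δ / 3) := by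
  refine ENNReal.ofReal_le_ofReal ?_
  have e : -3 * Real.log (2 / δ) = Real.log ((δ / 2) ^ 3) := by
    rw [Real.log_pow, ← inv_div, Real.log_inv]
    push_cast
    ring
  rw [e] at hy
  refine (Real.exp_le_exp.mpr hy).trans ?_
  rw [Real.exp_log (by positivity)]
  have : δ ^ 2 ≤ 1 := pow_le_one₀ h0.le h1.le
  nlinarith

variable {Z Y : Type*} [MetricSpace Z] [MeasurableSpace Z] [BorelSpace Z] [MeasurableSpace Y]
  {X : Set Z} {R n : ℕ} {loss : ℝ → Y → ℝ} {M : ℝ} {ρ : Measure (X × Y)} [IsProbabilityMeasure ρ]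
  {P : Measure Z} [IsProbabilityMeasure P]

lemma measurable_loss_linearFunction (hm : Measurable fun q : ℝ × Y => loss q.1 q.2) (γ : ℝ≥0)
    [SecondCountableTopology X] (w : EuclideanSpace ℝ (Fin R)) :
    Measurable fun p : (Fin R → Z) × (X × Y) => loss (linearFunction γ p.1 w p.2.1) p.2.2 := by
  exact hm.comp ((measurable_linearFunction_comp γ w measurable_fst
    (measurable_fst.comp measurable_snd)).prodMk (measurable_snd.comp measurable_snd))

lemma measurable_loss_linearFunction_sample (hm : Measurable fun q : ℝ × Y => loss q.1 q.2)
    (γ : ℝ≥0) [SecondCountableTopology X] (w : EuclideanSpace ℝ (Fin R)) (k : Fin n) :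
    Measurable fun q : (Fin n → X × Y) × (Fin R → Z) =>
      loss (linearFunction γ q.2 w (q.1 k).1) (q.1 k).2 := by
  have h : Measurable fun q : (Fin n → X × Y) × (Fin R → Z) => q.1 k :=
    (measurable_pi_apply k).comp measurable_fst
  exact hm.comp ((measurable_linearFunction_comp γ w measurable_snd
    (measurable_fst.comp h)).prodMk (measurable_snd.comp h))

/-- The event that the regularized deviation of the excess empirical risk is large. -/
lemma prod_measure_linearFunction_deviation_le (hM : 0 < M)
    (hm : Measurable fun q : ℝ × Y => loss q.1 q.2)
    (hLip : ∀ a b y, |loss a y - loss b y| ≤ M * |a - b|)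
    (γ : ℝ≥0) [SecondCountableTopology X] {ι : Type*} [Countable ι]
    (W : ι → EuclideanSpace ℝ (Fin R)) {b t : ℝ} (hb : 0 < b) (hn : 0 < n) :
    ((Measure.pi fun _ : Fin n => ρ).prod (Measure.pi fun _ : Fin R => P))
      {q | ∃ i, b * ‖W i‖ ^ 2 + t ≤
        ∫ z, (loss (linearFunction γ q.2 (W i) z.1) z.2 - loss 0 z.2) ∂ρ -
          (1 / (n : ℝ)) * ∑ k, (loss (linearFunction γ q.2 (W i) (q.1 k).1) (q.1 k).2 -
            loss 0 (q.1 k).2)} ≤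
      ENNReal.ofReal (Real.exp (1 / 2 - b * n * t / (4 * M ^ 2))) := by
  have h0 : Measurable fun z : X × Y => loss 0 z.2 :=
    hm.comp (measurable_const.prodMk measurable_snd)
  have hset : MeasurableSet {q : (Fin n → X × Y) × (Fin R → Z) | ∃ i, b * ‖W i‖ ^ 2 + t ≤
        ∫ z, (loss (linearFunction γ q.2 (W i) z.1) z.2 - loss 0 z.2) ∂ρ -
          (1 / (n : ℝ)) * ∑ k, (loss (linearFunction γ q.2 (W i) (q.1 k).1) (q.1 k).2 -
            loss 0 (q.1 k).2)} := by
    simp only [Set.ofPred_exists]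
    refine MeasurableSet.iUnion fun i => measurableSet_le measurable_const (Measurable.sub ?_ ?_)
    · have h1 : Measurable fun p : (Fin R → Z) × (X × Y) =>
          loss (linearFunction γ p.1 (W i) p.2.1) p.2.2 - loss 0 p.2.2 :=
        (measurable_loss_linearFunction hm γ (W i)).sub (h0.comp measurable_snd)
      exact (h1.stronglyMeasurable.integral_prod_right' (ν := ρ)).measurable.comp measurable_snd
    · refine Measurable.const_mul (Finset.measurable_sum _ fun k _ => Measurable.sub ?_ ?_) _
      · exact measurable_loss_linearFunction_sample hm γ (W i) k
      · exact h0.comp ((measurable_pi_apply k).comp measurable_fst)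
  rw [Measure.prod_apply_symm hset]
  refine (lintegral_mono fun ω =>
    measure_exists_linearFunction_deviation_le hM hm hLip γ ω W hb hn).trans ?_
  rw [lintegral_const, measure_univ, mul_one]

/-- The event that no weights in a dense sequence have a small regularized empirical risk. -/
lemma prod_measure_objective_ge_le {γ : ℝ≥0} (hM : 0 < M)
    (hm : Measurable fun q : ℝ × Y => loss q.1 q.2)
    (hLip : ∀ a b y, |loss a y - loss b y| ≤ M * |a - b|) [SecondCountableTopology X]
    (hn : 0 < n) (hR : 0 < R) {f : X → ℝ} (hf : Measurable f) {B ε μ s : ℝ} (hB : 0 < B)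
    (hε : 0 < ε) (hμ : 0 ≤ μ) (hs : ε / 8 + 2 * μ * B ^ 2 < s)
    (hf' : ∀ᵐ S ∂(Measure.pi fun _ : Fin n => ρ), ∃ h : KernelSpace γ P X, ‖h‖ ≤ B ∧
      empiricalRisk loss S h ≤ empiricalRisk loss S f) :
    ((Measure.pi fun _ : Fin n => ρ).prod (Measure.pi fun _ : Fin R => P))
      {q | ∀ i : ℕ, empiricalRisk loss q.1 f + s ≤ objective γ loss μ q.1 q.2
        (TopologicalSpace.denseSeq (EuclideanSpace ℝ (Fin R)) i)} ≤
      ENNReal.ofReal (Real.exp (1 - R * ε ^ 2 / (10240 * M ^ 2 * B ^ 2))) := by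
  have hset : MeasurableSet {q : (Fin n → X × Y) × (Fin R → Z) | ∀ i : ℕ,
      empiricalRisk loss q.1 f + s ≤ objective γ loss μ q.1 q.2
        (TopologicalSpace.denseSeq (EuclideanSpace ℝ (Fin R)) i)} := by
    simp only [Set.ofPred_forall]
    refine MeasurableSet.iInter fun i => measurableSet_le (Measurable.add_const ?_ _)
      (Measurable.add_const ?_ _)
    · refine Measurable.const_mul (Finset.measurable_sum _ fun k _ => ?_) _
      have h1 : Measurable fun q : (Fin n → X × Y) × (Fin R → Z) => q.1 k :=
        (measurable_pi_apply k).comp measurable_fst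
      exact hm.comp ((hf.comp (measurable_fst.comp h1)).prodMk (measurable_snd.comp h1))
    · exact Measurable.const_mul (Finset.measurable_sum _ fun k _ =>
        measurable_loss_linearFunction_sample hm γ _ k) _
  rw [Measure.prod_apply hset]
  have hae : ∀ᵐ S ∂(Measure.pi fun _ : Fin n => ρ),
      (Measure.pi fun _ : Fin R => P) (Prod.mk S ⁻¹' {q | ∀ i : ℕ,
        empiricalRisk loss q.1 f + s ≤ objective γ loss μ q.1 q.2
        (TopologicalSpace.denseSeq (EuclideanSpace ℝ (Fin R)) i)}) ≤
      ENNReal.ofReal (Real.exp (1 - R * ε ^ 2 / (10240 * M ^ 2 * B ^ 2))) := by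
    -- The comparison function `h` may depend on the sample in a nonmeasurable way; it appears only
    -- inside a fixed slice, while the event mentions just `f`.
    filter_upwards [hf'] with S hS
    obtain ⟨h, hh, hle⟩ := hS
    refine (measure_mono fun ω hω => ?_).trans
      (measure_objective_ge_le hM hLip hn hR S h hB hε hμ hh)
    rw [Set.mem_ofPred_eq]
    rintro ⟨w, hw⟩
    -- The strict inequality `hs` lets good weights be replaced by a member of the dense sequence,
    -- which keeps the event measurable.
    have hopen : IsOpen {v | objective γ loss μ S ω v < empiricalRisk loss S f + s} :=
      isOpen_lt (continuous_objective hM.le hLip γ μ S ω) continuous_const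
    obtain ⟨i, hi⟩ := (TopologicalSpace.denseRange_denseSeq
      (EuclideanSpace ℝ (Fin R))).exists_mem_open hopen ⟨w, by
        rw [Set.mem_ofPred_eq]; linarith⟩
    exact absurd (hω i) (not_le.mpr hi)
  refine (lintegral_mono_ae hae).trans ?_
  rw [lintegral_const, measure_univ, mul_one]

/-- Outside the three exceptional events, a minimizer of the regularized empirical risk has small
population risk. -/
lemma risk_estimator_sub_le (hM : 0 < M) (hm : Measurable fun q : ℝ × Y => loss q.1 q.2)
    (hLip : ∀ a b y, |loss a y - loss b y| ≤ M * |a - b|)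
    (h0 : Integrable (fun z : X × Y => loss 0 z.2) ρ) {γ : ℝ≥0} {μ t s r : ℝ}
    {f : X → ℝ} {K : ℝ} (hf : Measurable f) (hfK : ∀ x, |f x| ≤ K) {S : Fin n → X × Y}
    {ω : Fin R → Z}
    (h1 : ¬ ∃ i : ℕ, μ / 2 * ‖TopologicalSpace.denseSeq (EuclideanSpace ℝ (Fin R)) i‖ ^ 2 + t ≤
        ∫ z, (loss (linearFunction γ ω (TopologicalSpace.denseSeq _ i) z.1) z.2 - loss 0 z.2) ∂ρ -
          (1 / (n : ℝ)) * ∑ k, (loss (linearFunction γ ω (TopologicalSpace.denseSeq _ i)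
            (S k).1) (S k).2 - loss 0 (S k).2))
    (h2 : ¬ r ≤ (1 / (n : ℝ)) * ∑ k, (loss (f (S k).1) (S k).2 - loss 0 (S k).2) -
        ∫ z, (loss (f z.1) z.2 - loss 0 z.2) ∂ρ)
    (h3 : ¬ ∀ i : ℕ, empiricalRisk loss S f + s ≤ objective γ loss μ S ω
        (TopologicalSpace.denseSeq (EuclideanSpace ℝ (Fin R)) i))
    {g : X → ℝ} (hg : IsRandomFeatureEstimator γ loss μ S ω g) :
    risk loss ρ g - risk loss ρ f ≤ t + r + s := by
  obtain ⟨w, hw, rfl⟩ := hg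
  have hmeas : ∀ v : EuclideanSpace ℝ (Fin R), Measurable (linearFunction (X := X) γ ω v) := by
    intro v
    have h := measurable_inner_features (X := X) γ ω v
    simp only [← linearFunction_eq_inner] at h
    exact h
  have hint : ∀ v : EuclideanSpace ℝ (Fin R),
      Integrable (fun z : X × Y => loss (linearFunction γ ω v z.1) z.2) ρ := fun v =>
    integrable_loss hM.le hm hLip h0 (hmeas v) (abs_linearFunction_le γ ω v)
  have emp : ∀ q : X → ℝ, (1 / (n : ℝ)) * ∑ k, (loss (q (S k).1) (S k).2 - loss 0 (S k).2) =
      empiricalRisk loss S q - (1 / (n : ℝ)) * ∑ k, loss 0 (S k).2 := fun q => by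
    rw [Finset.sum_sub_distrib, mul_sub, empiricalRisk]
  have pop : ∀ q : X → ℝ, Integrable (fun z : X × Y => loss (q z.1) z.2) ρ →
      ∫ z, (loss (q z.1) z.2 - loss 0 z.2) ∂ρ = risk loss ρ q - ∫ z, loss 0 z.2 ∂ρ := fun q hq => by
    rw [integral_sub hq h0, risk]
  have hcr : Continuous fun v => risk loss ρ (linearFunction (X := X) γ ω v) :=
    continuous_of_abs_sub_le hM.le fun v v' =>
      abs_risk_sub_le hM.le hLip (hint v) (hint v') (abs_linearFunction_sub_le γ ω v v')
  have hce := continuous_empiricalRisk_linearFunction hM.le hLip γ S ω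
  -- The deviation bound extends by continuity from the dense sequence to all weights, in particular
  -- to the minimizer `w`.
  have key : ∀ v : EuclideanSpace ℝ (Fin R),
      risk loss ρ (linearFunction (X := X) γ ω v) - ∫ z, loss 0 z.2 ∂ρ -
        (empiricalRisk loss S (linearFunction γ ω v) - (1 / (n : ℝ)) * ∑ k, loss 0 (S k).2) ≤
      μ / 2 * ‖v‖ ^ 2 + t := by
    refine isClosed_property (TopologicalSpace.denseRange_denseSeq (EuclideanSpace ℝ (Fin R)))
      (isClosed_le ((hcr.sub continuous_const).sub (hce.sub continuous_const)) (by fun_prop))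
      fun i => ?_
    rw [not_exists] at h1
    have := not_le.mp (h1 i)
    rw [emp, pop _ (hint _)] at this
    exact this.le
  rw [emp, pop f (integrable_loss hM.le hm hLip h0 hf hfK), not_le] at h2
  rw [not_forall] at h3
  obtain ⟨i, hi⟩ := h3
  have h4 := hw (TopologicalSpace.denseSeq (EuclideanSpace ℝ (Fin R)) i)
  have h5 := key w
  unfold objective at h4 hi
  linarith

end Main

end D2KE

/-! ### Choice of constants and assembly -/

theorem mainTheorem5 :
    ∃ c₁ c₂ : ℝ, 0 < c₁ ∧ 0 < c₂ ∧
    ∀ C ε : ℝ, 0 < C → 0 < ε →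
    ∃ μ : ℝ, 0 < μ ∧
    -- metric space of objects, input domain, output space
    ∀ (Z : Type*) [MetricSpace Z] [MeasurableSpace Z] [BorelSpace Z] (X : Set Z)
      (Y : Type*) [MeasurableSpace Y]
      -- kernel parameters: `γ` and the distribution of the random objects
      (γ : ℝ≥0) (P : Measure Z) [IsProbabilityMeasure P]
      -- data distribution
      (ρ : Measure (X × Y)) [IsProbabilityMeasure ρ]
      (loss : ℝ → Y → ℝ) (M A δ : ℝ)
      (fstar : X → ℝ) (fC : D2KE.KernelSpace γ P X) (n R : ℕ),
      0 < γ →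
      (D2KE.coverExponents X).Nonempty →
      -- the loss is measurable and `M`-Lipschitz in its first argument; the risks exist
      0 < M →
      Measurable (fun q : ℝ × Y => loss q.1 q.2) →
      (∀ a b y, |loss a y - loss b y| ≤ M * |a - b|) →
      Integrable (fun z : X × Y => loss 0 z.2) ρ →
      Integrable (fun z : X × Y => loss (fstar z.1) z.2) ρ →
      0 < δ → δ < 1 →
      -- `f_C` minimizes the population risk over the ball and is close to the target
      D2KE.IsBallMinimizer (D2KE.risk loss ρ) C fC →
      D2KE.risk loss ρ fC - D2KE.risk loss ρ fstar ≤ ε / 2 →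
      -- `A` is at least `C`, or it bounds the coefficients of the empirical risk minimizer
      0 < A →
      (C ≤ A ∨ ∀ᵐ S ∂(Measure.pi fun _ : Fin n => ρ),
        D2KE.HasERMCoefficientBound γ P X loss C A S) →
      -- number of samples and number of random features
      c₁ * M ^ 2 * max (C ^ 2) (C ^ 4) * Real.log (2 / δ) / ε ^ 2 ≤ (n : ℝ) →
      c₂ * M ^ 2 * A ^ 2 *
        (D2KE.effectiveDimension X * Real.log (2 + 1 / ε) + Real.log (2 / δ)) / ε ^ 2 ≤ (R : ℝ) →
      -- outside an event of probability at most `δ` over the sample and the random objects,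
      -- the algorithm has an output, and each output is `ε`-suboptimal
      ((Measure.pi fun _ : Fin n => ρ).prod (Measure.pi fun _ : Fin R => P))
        {q : (Fin n → X × Y) × (Fin R → Z) |
          (∃ f, D2KE.IsRandomFeatureEstimator γ loss μ q.1 q.2 f) ∧
          ∀ f, D2KE.IsRandomFeatureEstimator γ loss μ q.1 q.2 f →
            D2KE.risk loss ρ f - D2KE.risk loss ρ fstar ≤ ε}ᶜ ≤ ENNReal.ofReal δ := by
  -- `6400 = 4 · 1600` and `51200 = 5 · 10240` make the deviation exponents at least `4Λ` and `5Λ`.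
  -- As `Λ ≥ 1/2`, the additive `1/2` and `1` are absorbed and each exponent is at most `-3Λ`. With
  -- this `μ` the norm cost `2μB²` is at most `ε/5`.
  refine ⟨6400, 51200, by norm_num, by norm_num, fun C ε hC hε => ⟨ε / (10 * C ^ 2),
    by positivity, ?_⟩⟩
  intro Z _ _ _ X Y _ γ P _ ρ _ loss M A δ fstar fC n R _ hX hM hm hLip h0 _ hδ0 hδ1 hfC hfstar hA
    hAC hn hR
  have hsc : SecondCountableTopology X :=
    D2KE.secondCountableTopology_of_coverExponents_nonempty hX
  set Λ := Real.log (2 / δ) with hΛ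
  have hΛ1 : 1 / 2 ≤ Λ := D2KE.half_le_log_two_div hδ0 hδ1
  set B := min A C with hB
  have hB0 : 0 < B := lt_min hA hC
  have hn1 : 6400 * M ^ 2 * C ^ 2 * Λ / ε ^ 2 ≤ n := by
    refine le_trans ?_ hn
    gcongr
    exact le_max_left _ _
  have hR1 : 51200 * M ^ 2 * B ^ 2 * Λ / ε ^ 2 ≤ R := by
    refine le_trans ?_ hR
    have h1 : 0 ≤ D2KE.effectiveDimension X * Real.log (2 + 1 / ε) :=
      mul_nonneg (D2KE.effectiveDimension_nonneg X) (Real.log_nonneg (by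
        have : 0 < 1 / ε := by positivity
        linarith))
    gcongr
    · exact min_le_left _ _
    · linarith
  have hn0 : 0 < n := Nat.cast_pos.mp (lt_of_lt_of_le (by positivity) hn1)
  have hR0 : 0 < R := Nat.cast_pos.mp (lt_of_lt_of_le (by positivity) hR1)
  rw [div_le_iff₀ (by positivity)] at hn1 hR1
  have hfCm : Measurable fC := (D2KE.continuous_coe_kernelSpace fC).measurable
  have hfCb : ∀ x, |fC x| ≤ C := fun x => (D2KE.abs_apply_le_norm fC x).trans hfC.1
  have b1 : 1 / 2 - ε / (10 * C ^ 2) / 2 * n * (ε / 20) / (4 * M ^ 2) ≤ -3 * Λ := by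
    have e : ε / (10 * C ^ 2) / 2 * n * (ε / 20) / (4 * M ^ 2) =
        n * ε ^ 2 / (1600 * M ^ 2 * C ^ 2) := by field_simp; norm_num
    have : 4 * Λ ≤ n * ε ^ 2 / (1600 * M ^ 2 * C ^ 2) := by
      rw [le_div_iff₀ (by positivity)]
      linarith
    rw [e]
    linarith
  have b3 : 1 - R * ε ^ 2 / (10240 * M ^ 2 * B ^ 2) ≤ -3 * Λ := by
    have : 5 * Λ ≤ R * ε ^ 2 / (10240 * M ^ 2 * B ^ 2) := by
      rw [le_div_iff₀ (by positivity)]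
      linarith
    linarith
  have hae : ∀ᵐ S ∂(Measure.pi fun _ : Fin n => ρ), ∃ h : D2KE.KernelSpace γ P X, ‖h‖ ≤ B ∧
      D2KE.empiricalRisk loss S h ≤ D2KE.empiricalRisk loss S fC := by
    rcases hAC with hAC | hAC
    · exact Filter.Eventually.of_forall fun S => ⟨fC, le_min (hfC.1.trans hAC) hfC.1, le_rfl⟩
    · filter_upwards [hAC] with S hS
      obtain ⟨h, α, hmin, hα, hαA⟩ := hS
      exact ⟨h, le_min (D2KE.norm_le_of_coefficients (fun i => (S i).1) hα hαA) hmin.1,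
        hmin.2 fC hfC.1⟩
  have m1 := (D2KE.prod_measure_linearFunction_deviation_le (P := P) (ρ := ρ) (R := R) hM hm hLip γ
    (TopologicalSpace.denseSeq (EuclideanSpace ℝ (Fin R))) (b := ε / (10 * C ^ 2) / 2)
    (t := ε / 20) (by positivity) hn0).trans (D2KE.ofReal_exp_le_of_le hδ0 hδ1 b1)
  have m2 := (D2KE.measure_empiricalRisk_deviation_le (ρ := ρ) hM hm hLip hfCm hC hfCb
    (b := ε / (10 * C ^ 2) / 2) (t := ε / 20) (by positivity) hn0).trans
    (D2KE.ofReal_exp_le_of_le hδ0 hδ1 b1)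
  -- In `s`, `ε/8` is the approximation error, `ε/5` the norm cost and `ε/80` the strict slack. With
  -- `t = ε/20` and `r = ε/10` the total is `39ε/80`, below the remaining `ε/2`.
  have m3 := (D2KE.prod_measure_objective_ge_le (μ := ε / (10 * C ^ 2))
    (s := ε / 8 + ε / 5 + ε / 80) hM hm hLip hn0 hR0 hfCm hB0 hε (by positivity) (by
      have h1 : B ^ 2 ≤ C ^ 2 := by
        gcongr
        exact min_le_right _ _
      have h2 : 2 * (ε / (10 * C ^ 2)) * B ^ 2 ≤ 2 * (ε / (10 * C ^ 2)) * C ^ 2 := by gcongr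
      have h3 : 2 * (ε / (10 * C ^ 2)) * C ^ 2 = ε / 5 := by field_simp; norm_num
      linarith) hae).trans (D2KE.ofReal_exp_le_of_le hδ0 hδ1 b3)
  set ν := (Measure.pi fun _ : Fin n => ρ).prod (Measure.pi fun _ : Fin R => P) with hν
  have m2' := Measure.prod_prod (μ := Measure.pi fun _ : Fin n => ρ)
    (ν := Measure.pi fun _ : Fin R => P) {S | ε / (10 * C ^ 2) / 2 * C ^ 2 + ε / 20 ≤
        (1 / (n : ℝ)) * ∑ k, (loss (fC (S k).1) (S k).2 - loss 0 (S k).2) -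
        ∫ z, (loss (fC z.1) z.2 - loss 0 z.2) ∂ρ} Set.univ
  rw [measure_univ, mul_one] at m2'
  rw [← m2'] at m2
  refine (measure_mono fun q hq => ?_).trans ((measure_union_le _ _).trans ((add_le_add
    ((measure_union_le _ _).trans (add_le_add m1 m2)) m3).trans (le_of_eq ?_)))
  · rw [Set.mem_compl_iff, Set.mem_ofPred_eq] at hq
    by_contra hcon
    rw [Set.mem_union, Set.mem_union, not_or, not_or, Set.mem_prod] at hcon
    obtain ⟨⟨h1, h2⟩, h3⟩ := hcon
    refine hq ⟨D2KE.exists_isRandomFeatureEstimator hM.le hLip γ (by positivity) q.1 q.2,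
      fun f hf => ?_⟩
    have h4 := D2KE.risk_estimator_sub_le hM hm hLip h0 hfCm hfCb h1
      (fun h => h2 ⟨h, Set.mem_univ _⟩) h3 hf
    have h5 : ε / (10 * C ^ 2) / 2 * C ^ 2 = ε / 20 := by field_simp; norm_num
    linarith
  · rw [← ENNReal.ofReal_add (by positivity) (by positivity),
      ← ENNReal.ofReal_add (by positivity) (by positivity)]
    congr 1
    ring
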